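/- Theorem 2.5. The base field is $\mathbb C$. Let $G$ be a finite group and let $V=\bigoplus_{i=1}^n V_i$ and $W=\bigoplus_{j=1}^m W_j$ be faithful finite dimensional $G$-modules, where the $V_i$ and $W_j$ are irreducible submodules. Terminology. A regular (resp. rational) covariant is a $G$-equivariant morphism (resp. rational map) between finite dimensional $G$-modules; its dimension is the dimension of the Zariski closure of its image, and it is faithful if $G$ acts faithfully on its image. A minimal regular (resp. rational) covariant is a faithful one whose dimension is the minimum $\operatorname{covdim} G$ (resp. $\operatorname{edim} G$) of the dimensions of all faithful regular (resp. rational) covariants between arbitrary finite dimensional $G$-modules. A regular or rational map $\phi=(\phi_1,\dots,\phi_m)\colon V\to W$ with all $\phi_j\neq 0$ is multihomogeneous if there is a matrix $A=(\alpha_{ji})\in M_{m\times n}(\mathbb Z)$ such that $$\phi_j(v_1,\dots,s v_i,\dots,v_n)=s^{\alpha_{ji}}\,\phi_j(v_1,\dots,v_n)\qquad\text{for all } i,\ j \text{ and all } s\in\mathbb C^*.$$ A multihomogeneous invariant is a nonzero function $h\in\mathcal O(V)^G$ such that, for some $d_1,\dots,d_n\in\mathbb N$, $h(v_1,\dots,s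 v_i,\dots,v_n)=s^{d_i}h(v_1,\dots,v_n)$ for all $i$ and all $s\in\mathbb C$. Then there is a minimal rational multihomogeneous covariant $\psi\colon V\dashrightarrow W$, all of whose components are nonzero, which is of the form $\psi=h^{-1}\phi$, where $h$ is a multihomogeneous invariant and $\phi\colon V\to W$ is a multihomogeneous minimal regular covariant. -/

import Mathlib

/-- The algebra `𝒪(V)` of regular (polynomial) functions on a complex vector space `V`:
the subalgebra of all functions `V → ℂ` generated by the linear forms. -/
def regularFunctions (V : Type*) [AddCommGroup V] [Module ℂ V] : Subalgebra ℂ (V → ℂ) :=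
  Algebra.adjoin ℂ (Set.range fun l : Module.Dual ℂ V => (l : V → ℂ))

/-- A map `φ : V → W` is regular (a morphism of varieties) if all its coordinates with respect to
linear forms on `W` are regular functions on `V`. -/
def IsRegularMap {V W : Type*} [AddCommGroup V] [Module ℂ V] [AddCommGroup W] [Module ℂ W]
    (φ : V → W) : Prop :=
  ∀ l : Module.Dual ℂ W, (fun v => l (φ v)) ∈ regularFunctions V

/-- The ideal of all regular functions on `W` which vanish on the set `S`. -/
def idealOfSet {W : Type*} [AddCommGroup W] [Module ℂ W] (S : Set W) :
    Ideal (regularFunctions W) where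
  carrier := {f | ∀ w ∈ S, (f : W → ℂ) w = 0}
  zero_mem' := fun _ _ => rfl
  add_mem' := by
    intro f g hf hg w hw
    have h1 := hf w hw
    have h2 := hg w hw
    simp [h1, h2]
  smul_mem' := by
    intro c f hf w hw
    have h1 := hf w hw
    simp [h1]

/-- The dimension of the Zariski closure of `S ⊆ W`: the transcendence degree over `ℂ` of the
coordinate ring `𝒪(W) / I(S)` of that closure, that is, the largest number of algebraically
independent regular functions on it. -/
noncomputable def zariskiDim {W : Type*} [AddCommGroup W] [Module ℂ W] (S : Set W) : ℕ∞ :=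
  Cardinal.toENat (Algebra.trdeg ℂ (regularFunctions W ⧸ idealOfSet S))

/-- A set is Zariski open if it is a union of principal open sets `{f ≠ 0}`. -/
def IsZariskiOpen {V : Type*} [AddCommGroup V] [Module ℂ V] (U : Set V) : Prop :=
  ∀ u ∈ U, ∃ f ∈ regularFunctions V, f u ≠ 0 ∧ ∀ v, f v ≠ 0 → v ∈ U

/-- A rational map `V ⇢ W`, given by a representative: a map to `W` which is defined and regular on
some nonempty (hence dense) Zariski open subset `dom` of `V`. Two representatives give the same
rational map if they agree where both are defined. All notions below only depend on the
rational map. -/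
structure RationalMap (V W : Type*) [AddCommGroup V] [Module ℂ V]
    [AddCommGroup W] [Module ℂ W] where
  /-- the open set on which the representative is defined -/
  dom : Set V
  /-- the map on this open set -/
  toFun : dom → W
  isOpen_dom : IsZariskiOpen dom
  nonempty_dom : dom.Nonempty
  /-- locally, the map is a quotient of a regular map by a regular function -/
  regular : ∀ u : dom, ∃ p : V → W, ∃ f : V → ℂ, IsRegularMap p ∧ f ∈ regularFunctions V ∧
    f u ≠ 0 ∧ ∀ v : dom, f v ≠ 0 → toFun v = (f v)⁻¹ • p v

/-- The rational map `ψ` equals `h⁻¹ φ`. -/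
def RationalMap.EqQuotient {V W : Type*} [AddCommGroup V] [Module ℂ V]
    [AddCommGroup W] [Module ℂ W] (ψ : RationalMap V W) (h : V → ℂ) (φ : V → W) : Prop :=
  ∀ v : ψ.dom, h v ≠ 0 → ψ.toFun v = (h v)⁻¹ • φ v

/-- The direct sum `⨁ i, V i` (a finite one, realised as the product) of representations. -/
def piRep {G ι : Type*} [Group G] {V : ι → Type*} [∀ i, AddCommGroup (V i)] [∀ i, Module ℂ (V i)]
    (ρ : ∀ i, Representation ℂ G (V i)) : Representation ℂ G (∀ i, V i) where
  toFun g := LinearMap.pi fun i => (ρ i g) ∘ₗ LinearMap.proj i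
  map_one' := by ext; simp
  map_mul' g h := by ext; simp

section Covariants

variable {G : Type*} [Group G] {V W : Type*} [AddCommGroup V] [Module ℂ V]
  [AddCommGroup W] [Module ℂ W]

/-- Only the identity of `G` fixes the subset `S` of the `G`-module `W` pointwise. -/
def ActsFaithfullyOn (σ : Representation ℂ G W) (S : Set W) : Prop :=
  ∀ g : G, (∀ w ∈ S, σ g w = w) → g = 1

/-- A (regular) covariant: a `G`-equivariant morphism between `G`-modules. -/
def IsCovariant (ρ : Representation ℂ G V) (σ : Representation ℂ G W) (φ : V → W) : Prop :=
  IsRegularMap φ ∧ ∀ g v, φ (ρ g v) = σ g (φ v)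

/-- A rational covariant: a `G`-equivariant rational map between `G`-modules. -/
def IsRationalCovariant (ρ : Representation ℂ G V) (σ : Representation ℂ G W)
    (ψ : RationalMap V W) : Prop :=
  ∀ (g : G) (v v' : ψ.dom), (v' : V) = ρ g v → ψ.toFun v' = σ g (ψ.toFun v)

/-- A faithful (regular) covariant: `G` acts faithfully on the image. -/
def IsFaithfulCovariant (ρ : Representation ℂ G V) (σ : Representation ℂ G W) (φ : V → W) :
    Prop :=
  IsCovariant ρ σ φ ∧ ActsFaithfullyOn σ (Set.range φ)

/-- A faithful rational covariant: `G` acts faithfully on the image. -/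
def IsFaithfulRationalCovariant (ρ : Representation ℂ G V) (σ : Representation ℂ G W)
    (ψ : RationalMap V W) : Prop :=
  IsRationalCovariant ρ σ ψ ∧ ActsFaithfullyOn σ (Set.range ψ.toFun)

end Covariants

/-- The covariant dimension of `G`: the minimal dimension of a faithful covariant between any two
finite dimensional `G`-modules. (Every universe contains all such modules up to isomorphism.) -/
noncomputable def covdim.{u, v} (G : Type v) [Group G] : ℕ∞ :=
  sInf {d | ∃ (V W : Type u) (_ : AddCommGroup V) (_ : Module ℂ V) (_ : FiniteDimensional ℂ V)
    (_ : AddCommGroup W) (_ : Module ℂ W) (_ : FiniteDimensional ℂ W)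
    (ρ : Representation ℂ G V) (σ : Representation ℂ G W) (φ : V → W),
    IsFaithfulCovariant ρ σ φ ∧ d = zariskiDim (Set.range φ)}

/-- The essential dimension of `G`: the minimal dimension of a faithful rational covariant between
any two finite dimensional `G`-modules. -/
noncomputable def edim.{u, v} (G : Type v) [Group G] : ℕ∞ :=
  sInf {d | ∃ (V W : Type u) (_ : AddCommGroup V) (_ : Module ℂ V) (_ : FiniteDimensional ℂ V)
    (_ : AddCommGroup W) (_ : Module ℂ W) (_ : FiniteDimensional ℂ W)
    (ρ : Representation ℂ G V) (σ : Representation ℂ G W) (ψ : RationalMap V W),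
    IsFaithfulRationalCovariant ρ σ ψ ∧ d = zariskiDim (Set.range ψ.toFun)}

/-- A minimal (regular) covariant: a faithful covariant whose dimension is `covdim G`. -/
def IsMinimalCovariant.{u, v} {G : Type v} [Group G] {V W : Type u} [AddCommGroup V] [Module ℂ V]
    [AddCommGroup W] [Module ℂ W] (ρ : Representation ℂ G V) (σ : Representation ℂ G W)
    (φ : V → W) : Prop :=
  IsFaithfulCovariant ρ σ φ ∧ zariskiDim (Set.range φ) = covdim.{u, v} G

/-- A minimal rational covariant: a faithful rational covariant whose dimension is `edim G`. -/
def IsMinimalRationalCovariant.{u, v} {G : Type v} [Group G] {V W : Type u} [AddCommGroup V]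
    [Module ℂ V] [AddCommGroup W] [Module ℂ W] (ρ : Representation ℂ G V)
    (σ : Representation ℂ G W) (ψ : RationalMap V W) : Prop :=
  IsFaithfulRationalCovariant ρ σ ψ ∧ zariskiDim (Set.range ψ.toFun) = edim.{u, v} G

section Multihomogeneous

variable {ι κ : Type*} [DecidableEq ι] {V : ι → Type*} {W : κ → Type*}
  [∀ i, AddCommGroup (V i)] [∀ i, Module ℂ (V i)] [∀ j, AddCommGroup (W j)] [∀ j, Module ℂ (W j)]

/-- `(v₁, …, s vᵢ, …, vₙ)`. -/
def scaleAt (i : ι) (s : ℂ) (v : ∀ i, V i) : ∀ i, V i :=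
  Function.update v i (s • v i)

/-- The map `φ = (φ_j)_j : ⨁ V i → ⨁ W j` is multihomogeneous of degree `A`: no component is zero
and `φ_j (v₁, …, s vᵢ, …, vₙ) = s ^ A j i • φ_j (v₁, …, vₙ)`. -/
def IsMultihomogeneousOfDegree (A : Matrix κ ι ℤ) (φ : (∀ i, V i) → ∀ j, W j) : Prop :=
  (∀ j, ∃ v, φ v j ≠ 0) ∧
    ∀ (j : κ) (i : ι) (s : ℂ), s ≠ 0 → ∀ v, φ (scaleAt i s v) j = s ^ A j i • φ v j

/-- The same for rational maps: the identity is required wherever both sides are defined. -/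
def RationalMap.IsMultihomogeneousOfDegree (A : Matrix κ ι ℤ)
    (ψ : RationalMap (∀ i, V i) (∀ j, W j)) : Prop :=
  (∀ j, ∃ v, ψ.toFun v j ≠ 0) ∧
    ∀ (j : κ) (i : ι) (s : ℂ), s ≠ 0 → ∀ v v' : ψ.dom, (v' : ∀ i, V i) = scaleAt i s v →
      ψ.toFun v' j = s ^ A j i • ψ.toFun v j

/-- A multihomogeneous invariant: a nonzero `G`-invariant regular function `h` on `⨁ V i` which is
homogeneous of some degree in each of the variables `vᵢ`. -/
def IsMultihomogeneousInvariant {G : Type*} [Group G] (ρ : ∀ i, Representation ℂ G (V i))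
    (h : (∀ i, V i) → ℂ) : Prop :=
  h ∈ regularFunctions (∀ i, V i) ∧ h ≠ 0 ∧ (∀ g v, h (piRep ρ g v) = h v) ∧
    ∃ d : ι → ℕ, ∀ (i : ι) (s : ℂ) (v), h (scaleAt i s v) = s ^ d i * h v

end Multihomogeneous

universe u v

/-! Take a faithful rational covariant of dimension edim between some modules and write it as a
covariant over an invariant. A generic point and its image have trivial stabilizers, and covariants
can take any value at such points. Hence there are a covariant from `V` to its source through a
generic point, and one from its target to `W` whose value at the image point has all components
nonzero. The composite does not raise the dimension (`IsCovariantQuotient.exists_compression`).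

Next, for each `i` in turn, the denominator and all components of the numerator are replaced by
their leading terms in `v i`. Since `G` commutes with scaling, equivariance survives. The dimension
does not grow (`AlgIndepOn.of_tendsto`): a relation between coordinates of the old map has a top
weighted part, which is a relation between coordinates of the new one. Faithfulness is automatic:
each `W j` is irreducible, so it is spanned by the image of a nonzero component.

This gives a minimal rational `h⁻¹ φ`, and clearing `h` costs at most one dimension
(`zariskiDim_range_le_add_one`). If edim < covdim, then `φ` has dimension at most edim + 1 ≤ covdim,
so it is minimal. Otherwise the construction is run on a minimal regular covariant with denominator
1; the denominator stays 1, and the resulting map serves as both `ψ` and `φ`. -/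

/-! ### Regular functions and regular maps; density of principal open sets -/

section RegularFunctions

variable {V W X : Type*} [AddCommGroup V] [Module ℂ V] [AddCommGroup W] [Module ℂ W]
  [AddCommGroup X] [Module ℂ X]

theorem dual_mem_regularFunctions (l : Module.Dual ℂ V) : (fun v => l v) ∈ regularFunctions V :=
  Algebra.subset_adjoin ⟨l, rfl⟩

theorem const_mem_regularFunctions (c : ℂ) : (fun _ => c) ∈ regularFunctions V :=
  (regularFunctions V).algebraMap_mem c

theorem mul_mem_regularFunctions {f g : V → ℂ} (hf : f ∈ regularFunctions V)
    (hg : g ∈ regularFunctions V) : (fun v => f v * g v) ∈ regularFunctions V :=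
  mul_mem hf hg

theorem pow_mem_regularFunctions {f : V → ℂ} (hf : f ∈ regularFunctions V) (n : ℕ) :
    (fun v => f v ^ n) ∈ regularFunctions V :=
  pow_mem hf n

theorem sum_mem_regularFunctions {ι : Type*} (s : Finset ι) {f : ι → V → ℂ}
    (hf : ∀ i ∈ s, f i ∈ regularFunctions V) : (fun v => ∑ i ∈ s, f i v) ∈ regularFunctions V := by
  have := sum_mem hf
  convert this using 1
  ext v; simp

theorem prod_mem_regularFunctions {ι : Type*} (s : Finset ι) {f : ι → V → ℂ}
    (hf : ∀ i ∈ s, f i ∈ regularFunctions V) : (fun v => ∏ i ∈ s, f i v) ∈ regularFunctions V := by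
  have := prod_mem hf
  convert this using 1
  ext v; simp

theorem IsRegularMap.linearMap (f : V →ₗ[ℂ] W) : IsRegularMap f := fun l =>
  dual_mem_regularFunctions (l ∘ₗ f)

theorem IsRegularMap.const (w : W) : IsRegularMap fun _ : V => w := fun l =>
  const_mem_regularFunctions (l w)

theorem IsRegularMap.smul {f : V → ℂ} {φ : V → W} (hf : f ∈ regularFunctions V)
    (hφ : IsRegularMap φ) : IsRegularMap fun v => f v • φ v := fun l => by
  simpa using mul_mem_regularFunctions hf (hφ l)

theorem IsRegularMap.add {φ χ : V → W} (hφ : IsRegularMap φ)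
    (hχ : IsRegularMap χ) : IsRegularMap fun v => φ v + χ v := fun l => by
  have h := add_mem (hφ l) (hχ l)
  convert h using 1
  ext v; simp

theorem IsRegularMap.sum {ι : Type*} (s : Finset ι) {φ : ι → V → W}
    (hφ : ∀ i ∈ s, IsRegularMap (φ i)) : IsRegularMap fun v => ∑ i ∈ s, φ i v := fun l => by
  simpa using sum_mem_regularFunctions s (fun i hi => hφ i hi l)

theorem comp_mem_regularFunctions {f : W → ℂ} {φ : V → W} (hf : f ∈ regularFunctions W)
    (hφ : IsRegularMap φ) : (fun v => f (φ v)) ∈ regularFunctions V := by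
  induction hf using Algebra.adjoin_induction with
  | mem x hx => obtain ⟨l, rfl⟩ := hx; exact hφ l
  | algebraMap r => exact const_mem_regularFunctions r
  | add x y _ _ hx hy => exact add_mem hx hy
  | mul x y _ _ hx hy => exact mul_mem hx hy

theorem IsRegularMap.comp {χ : W → X} {φ : V → W} (hχ : IsRegularMap χ) (hφ : IsRegularMap φ) :
    IsRegularMap fun v => χ (φ v) := fun l =>
  comp_mem_regularFunctions (f := fun w => l (χ w)) (hχ l) hφ

theorem IsRegularMap.prodMk {χ : V → X} {φ : V → W} (hχ : IsRegularMap χ) (hφ : IsRegularMap φ) :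
    IsRegularMap fun v => (χ v, φ v) := by
  have h := ((IsRegularMap.linearMap (LinearMap.inl ℂ X W)).comp hχ).add
    ((IsRegularMap.linearMap (LinearMap.inr ℂ X W)).comp hφ)
  simpa using h

theorem isRegularMap_of_mem {f : V → ℂ} (hf : f ∈ regularFunctions V) : IsRegularMap f := by
  simpa using IsRegularMap.smul hf (IsRegularMap.const (1 : ℂ))

theorem IsRegularMap.pi {ι : Type*} [Fintype ι] {W : ι → Type*} [∀ i, AddCommGroup (W i)]
    [∀ i, Module ℂ (W i)] {φ : V → ∀ i, W i} (hφ : ∀ i, IsRegularMap fun v => φ v i) :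
    IsRegularMap φ := by
  classical
  have h := IsRegularMap.sum Finset.univ fun i _ =>
    (IsRegularMap.linearMap (LinearMap.single ℂ W i)).comp (hφ i)
  convert h using 2 with v
  exact (LinearMap.sum_single_apply W (φ v)).symm

theorem IsRegularMap.apply {ι : Type*} {W : ι → Type*} [∀ i, AddCommGroup (W i)]
    [∀ i, Module ℂ (W i)] {φ : V → ∀ i, W i} (hφ : IsRegularMap φ) (i : ι) :
    IsRegularMap fun v => φ v i :=
  (IsRegularMap.linearMap (LinearMap.proj (R := ℂ) (φ := W) i)).comp hφ

theorem exists_polynomial_on_line {f : V → ℂ} (hf : f ∈ regularFunctions V) (a b : V) :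
    ∃ P : Polynomial ℂ, ∀ t : ℂ, f (a + t • b) = P.eval t := by
  induction hf using Algebra.adjoin_induction with
  | mem x hx =>
    obtain ⟨l, rfl⟩ := hx
    exact ⟨.C (l a) + .C (l b) * .X, fun t => by simp [mul_comm t]⟩
  | algebraMap r => exact ⟨.C r, fun t => by simp⟩
  | add x y _ _ hx hy =>
    obtain ⟨P, hP⟩ := hx
    obtain ⟨Q, hQ⟩ := hy
    exact ⟨P + Q, fun t => by simp [hP, hQ]⟩
  | mul x y _ _ hx hy =>
    obtain ⟨P, hP⟩ := hx
    obtain ⟨Q, hQ⟩ := hy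
    exact ⟨P * Q, fun t => by simp [hP, hQ]⟩

/-- On the line through the two given points both functions are nonzero polynomials in one variable,
and `ℂ[t]` is a domain. -/
theorem exists_mul_ne_zero {f g : V → ℂ} (hf : f ∈ regularFunctions V)
    (hg : g ∈ regularFunctions V) (hf0 : ∃ v, f v ≠ 0) (hg0 : ∃ v, g v ≠ 0) :
    ∃ v, f v ≠ 0 ∧ g v ≠ 0 := by
  obtain ⟨a, ha⟩ := hf0
  obtain ⟨b, hb⟩ := hg0
  obtain ⟨P, hP⟩ := exists_polynomial_on_line hf a (b - a)
  obtain ⟨Q, hQ⟩ := exists_polynomial_on_line hg a (b - a)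
  by_contra! h
  have hPQ : P * Q = 0 := Polynomial.funext fun t => by
    rw [Polynomial.eval_mul, ← hP, ← hQ, Polynomial.eval_zero, mul_eq_zero]
    exact or_iff_not_imp_left.2 (h _)
  rcases mul_eq_zero.1 hPQ with h0 | h0
  · apply ha
    simpa [h0] using hP 0
  · apply hb
    simpa [h0] using hQ 1

theorem exists_forall_ne_zero {ι : Type*} (s : Finset ι) {f : ι → V → ℂ}
    (hf : ∀ i ∈ s, f i ∈ regularFunctions V) (hf0 : ∀ i ∈ s, ∃ v, f i v ≠ 0) :
    ∃ v, ∀ i ∈ s, f i v ≠ 0 := by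
  classical
  induction s using Finset.induction_on with
  | empty => exact ⟨0, by simp⟩
  | insert a s ha ih =>
    simp only [Finset.mem_insert, forall_eq_or_imp] at hf hf0 ⊢
    obtain ⟨v, hv⟩ := ih hf.2 hf0.2
    obtain ⟨w, hw, hw'⟩ := exists_mul_ne_zero hf.1 (prod_mem_regularFunctions s hf.2) hf0.1
      ⟨v, Finset.prod_ne_zero_iff.2 hv⟩
    exact ⟨w, hw, Finset.prod_ne_zero_iff.1 hw'⟩

theorem eq_zero_of_forall_ne_zero {h f : V → ℂ} (hh : h ∈ regularFunctions V)
    (hf : f ∈ regularFunctions V) (hh0 : ∃ v, h v ≠ 0) (H : ∀ v, h v ≠ 0 → f v = 0) (v : V) :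
    f v = 0 := by
  by_contra hv
  obtain ⟨w, hw, hw'⟩ := exists_mul_ne_zero hh hf hh0 ⟨v, hv⟩
  exact hw' (H w hw)

/-- The density principle: identities are checked away from the zeros of a denominator and then hold
everywhere. -/
theorem IsRegularMap.eq_of_forall_ne_zero {h : V → ℂ} {φ χ : V → W}
    (hh : h ∈ regularFunctions V) (hφ : IsRegularMap φ) (hχ : IsRegularMap χ)
    (hh0 : ∃ v, h v ≠ 0) (H : ∀ v, h v ≠ 0 → φ v = χ v) (v : V) : φ v = χ v := by
  rw [← sub_eq_zero, ← Module.forall_dual_apply_eq_zero_iff ℂ]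
  intro l
  have := eq_zero_of_forall_ne_zero (f := fun v => l (φ v) - l (χ v)) hh
    (sub_mem (hφ l) (hχ l)) hh0 (fun v hv => by simp [H v hv]) v
  simpa using this

theorem exists_mem_regularFunctions_ne_zero {φ : V → W} (hφ : IsRegularMap φ) {v : V}
    (hv : φ v ≠ 0) : ∃ f ∈ regularFunctions V, f v ≠ 0 ∧ ∀ u, f u ≠ 0 → φ u ≠ 0 := by
  have h := (Module.forall_dual_apply_eq_zero_iff ℂ (φ v)).not.2 hv
  push Not at h
  obtain ⟨l, hl⟩ := h
  exact ⟨_, hφ l, hl, fun u hu h0 => hu (by simp [h0])⟩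

end RegularFunctions

/-! ### Covariants with prescribed values and generic points -/

section Interpolation

variable {G V W : Type*} [Group G] [Finite G] [AddCommGroup V] [Module ℂ V]
  [AddCommGroup W] [Module ℂ W]

/-- A covariant may take any value at a point with trivial stabilizer. -/
theorem exists_covariant_apply_eq (ρ : Representation ℂ G V) (σ : Representation ℂ G W) {v : V}
    (hv : ∀ g : G, g ≠ 1 → ρ g v ≠ v) (w : W) : ∃ φ, IsCovariant ρ σ φ ∧ φ v = w := by
  classical
  have := Fintype.ofFinite G
  have hl : ∀ g : G, ∃ l : Module.Dual ℂ V, g ≠ 1 → l (v - ρ g v) ≠ 0 := fun g => by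
    by_cases hg : g = 1
    · exact ⟨0, fun h => (h hg).elim⟩
    · have h := (Module.forall_dual_apply_eq_zero_iff ℂ (v - ρ g v)).not.2
        (sub_ne_zero.2 (hv g hg).symm)
      push Not at h
      exact h.imp fun l hl _ => hl
  choose l hl using hl
  -- Each factor separates `v` from one translate, so `e` is 1 at `v` and 0 on the rest of the
  -- orbit. Summing the translates of `e • w` over `G` then gives a covariant, and only `g = 1`
  -- contributes at `v`.
  set e : V → ℂ := fun x =>
    ∏ g ∈ Finset.univ.erase (1 : G), (l g (v - ρ g v))⁻¹ * (l g x - l g (ρ g v)) with he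
  have hreg : e ∈ regularFunctions V := prod_mem_regularFunctions _ fun g _ =>
    mul_mem_regularFunctions (const_mem_regularFunctions _)
      (sub_mem (dual_mem_regularFunctions (l g)) (const_mem_regularFunctions _))
  have he1 : e v = 1 := Finset.prod_eq_one fun g hg => by
    rw [← map_sub]
    exact inv_mul_cancel₀ (hl g (Finset.ne_of_mem_erase hg))
  have he0 : ∀ g : G, g ≠ 1 → e (ρ g v) = 0 := fun g hg =>
    Finset.prod_eq_zero (Finset.mem_erase.2 ⟨hg, Finset.mem_univ g⟩) (by simp)
  refine ⟨fun x => ∑ g : G, e (ρ g⁻¹ x) • σ g w, ⟨IsRegularMap.sum _ fun g _ =>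
    (IsRegularMap.const _).smul (comp_mem_regularFunctions hreg (.linearMap (ρ g⁻¹))), ?_⟩, ?_⟩
  · intro k x
    rw [map_sum]
    refine (Fintype.sum_equiv (Equiv.mulLeft k) _ _ fun g => ?_).symm
    rw [map_smul, ← Module.End.mul_apply, ← Module.End.mul_apply, ← map_mul, ← map_mul]
    simp
  · refine (Finset.sum_eq_single (1 : G) ?_ ?_).trans ?_
    · intro g _ hg
      rw [he0 g⁻¹ (by simpa using hg), zero_smul]
    · simp
    · simp [he1]

/-- The image under a faithful map of a generic point has trivial stabilizer, and finitely many
nonzero regular maps do not vanish there. -/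
theorem exists_forall_ne_of_faithful {X : Type*} [AddCommGroup X] [Module ℂ X]
    (σ : Representation ℂ G W) {φ : X → W} (hφ : IsRegularMap φ) {ι : Type*} [Finite ι]
    {Y : ι → Type*} [∀ i, AddCommGroup (Y i)] [∀ i, Module ℂ (Y i)] {χ : ∀ i, X → Y i}
    (hχ : ∀ i, IsRegularMap (χ i)) (hχ0 : ∀ i, ∃ v, χ i v ≠ 0)
    (hf : ActsFaithfullyOn σ (Set.range φ)) :
    ∃ x, (∀ g : G, g ≠ 1 → σ g (φ x) ≠ φ x) ∧ ∀ i, χ i x ≠ 0 := by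
  have key : ∀ g : {g : G // g ≠ 1}, ∃ x, σ g (φ x) - φ x ≠ 0 := fun g => by
    by_contra! h
    exact g.2 (hf g (by rintro _ ⟨x, rfl⟩; exact sub_eq_zero.1 (h x)))
  choose a ha using key
  choose f hf hfu hfφ using fun g : {g : G // g ≠ 1} => exists_mem_regularFunctions_ne_zero
    (φ := fun x => σ g (φ x) - φ x) (by
      simpa [sub_eq_add_neg] using ((IsRegularMap.linearMap (σ g.1)).comp hφ).add
        ((IsRegularMap.linearMap (-LinearMap.id)).comp hφ)) (ha g)
  choose b hb using hχ0
  choose f' hf' hfu' hfφ' using fun i => exists_mem_regularFunctions_ne_zero (hχ i) (hb i)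
  have := Fintype.ofFinite ι
  have := Fintype.ofFinite {g : G // g ≠ 1}
  obtain ⟨x, hx⟩ := exists_forall_ne_zero (V := X)
    (Finset.univ : Finset ({g : G // g ≠ 1} ⊕ ι)) (f := Sum.elim f f')
    (by rintro (g | i) _; exacts [hf g, hf' i])
    (by rintro (g | i) _; exacts [⟨_, hfu g⟩, ⟨_, hfu' i⟩])
  refine ⟨x, fun g hg => sub_ne_zero.1 (hfφ ⟨g, hg⟩ x ?_), fun i => hfφ' i x ?_⟩
  · exact hx (.inl ⟨g, hg⟩) (Finset.mem_univ _)
  · exact hx (.inr i) (Finset.mem_univ _)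

end Interpolation

/-! ### Transcendence degree of quotient algebras -/

section QuotientTrdeg

variable {k A B κ : Type*} [Field k] [CommRing A] [Algebra k A] [CommRing B] [Algebra k B]

/-- The transcendence degree of a quotient algebra. -/
noncomputable def quotientTrdeg (k : Type*) {A : Type*} [Field k] [CommRing A] [Algebra k A]
    (I : Ideal A) : Cardinal :=
  Algebra.trdeg k (A ⧸ I)

theorem quotientTrdeg_anti {I J : Ideal A} (h : I ≤ J) : quotientTrdeg k J ≤ quotientTrdeg k I :=
  trdeg_le_of_surjective (Ideal.Quotient.factorₐ k h) (Ideal.Quotient.factor_surjective h)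

theorem lift_quotientTrdeg_comap_le.{u₁, u₂} {A : Type u₁} {B : Type u₂} [CommRing A] [Algebra k A]
    [CommRing B] [Algebra k B] (f : A →ₐ[k] B) (J : Ideal B) :
    Cardinal.lift.{u₂} (quotientTrdeg k (J.comap f)) ≤ Cardinal.lift.{u₁} (quotientTrdeg k J) :=
  lift_trdeg_le_of_injective (Ideal.quotientMapₐ J f le_rfl)
    (Ideal.quotientMap_injective' (f := f.toRingHom) (H := le_rfl) le_rfl)

/-- A finite generating family of a domain contains a transcendence basis. -/
theorem exists_algebraicIndependent_of_adjoin_eq_top [IsDomain A] [Fintype κ] {x : κ → A}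
    (hx : Algebra.adjoin k (Set.range x) = ⊤) :
    ∃ J : Finset κ, AlgebraicIndependent k (fun j : J => x j) ∧ Algebra.trdeg k A = J.card := by
  classical
  have : Algebra.IsAlgebraic (Algebra.adjoin k (Set.range x)) A :=
    ⟨fun a => isAlgebraic_algebraMap (⟨a, hx ▸ Algebra.mem_top⟩ : Algebra.adjoin k (Set.range x))⟩
  obtain ⟨t, ht, hb⟩ := exists_isTranscendenceBasis_subset (R := k) (Set.range x)
  -- The family `x` may repeat values, so one index is picked for each basis element.
  choose c hc using fun a : t => ht a.2
  have hfin : Finite t := (Set.finite_range x).subset ht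
  have := Fintype.ofFinite t
  have hcinj : Function.Injective c := fun a b hab => by
    apply Subtype.ext
    rw [← hc a, ← hc b, hab]
  refine ⟨Finset.univ.image c, ?_, ?_⟩
  · let e : t ≃ (Finset.univ.image c : Finset κ) :=
      Equiv.ofBijective (fun a => ⟨c a, Finset.mem_image_of_mem c (Finset.mem_univ a)⟩)
        ⟨fun a b hab => hcinj (congrArg Subtype.val hab), fun ⟨k, hk⟩ => by
          obtain ⟨a, -, rfl⟩ := Finset.mem_image.1 hk
          exact ⟨a, rfl⟩⟩
    rw [← algebraicIndependent_equiv' e (f := fun j => x j) (g := fun a : t => (a : A)) (funext hc)]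
    exact hb.1
  · rw [← hb.cardinalMk_eq_trdeg, Finset.card_image_of_injective _ hcinj]
    simp

theorem algebraicIndependent_quotient_mk_iff (I : Ideal A) (x : κ → A) :
    AlgebraicIndependent k (fun i => Ideal.Quotient.mkₐ k I (x i)) ↔
      ∀ P : MvPolynomial κ k, MvPolynomial.aeval x P ∈ I → P = 0 := by
  rw [algebraicIndependent_iff]
  refine forall_congr' fun P => imp_congr_left ?_
  rw [← Ideal.Quotient.eq_zero_iff_mem, ← Ideal.Quotient.mkₐ_eq_mk k,
    MvPolynomial.comp_aeval_apply]

theorem natCast_card_le_quotientTrdeg [Fintype κ] {I : Ideal A} {x : κ → A}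
    (h : ∀ P : MvPolynomial κ k, MvPolynomial.aeval x P ∈ I → P = 0) :
    (Fintype.card κ : Cardinal) ≤ quotientTrdeg k I := by
  simpa [quotientTrdeg] using
    ((algebraicIndependent_quotient_mk_iff I x).2 h).lift_cardinalMk_le_trdeg

theorem exists_quotientTrdeg_eq_card {I : Ideal A} [I.IsPrime] [Fintype κ] {x : κ → A}
    (hx : Algebra.adjoin k (Set.range x) = ⊤) :
    ∃ J : Finset κ, (∀ P : MvPolynomial J k, MvPolynomial.aeval (fun j : J => x j) P ∈ I → P = 0) ∧
      quotientTrdeg k I = J.card := by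
  have h := congrArg (Subalgebra.map (Ideal.Quotient.mkₐ k I)) hx
  rw [AlgHom.map_adjoin, ← Set.range_comp, Algebra.map_top,
    (AlgHom.range_eq_top _).2 (Ideal.Quotient.mkₐ_surjective k I)] at h
  obtain ⟨J, hJ, hd⟩ := exists_algebraicIndependent_of_adjoin_eq_top h
  exact ⟨J, (algebraicIndependent_quotient_mk_iff I _).1 hJ, hd⟩

end QuotientTrdeg

/-! ### Dimension of Zariski closures -/

section Dimension

variable {V W : Type*} [AddCommGroup V] [Module ℂ V] [AddCommGroup W] [Module ℂ W]

theorem mem_idealOfSet {S : Set W} {f : regularFunctions W} :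
    f ∈ idealOfSet S ↔ ∀ w ∈ S, (f : W → ℂ) w = 0 :=
  Iff.rfl

theorem zariskiDim_eq (S : Set W) :
    zariskiDim S = Cardinal.toENat (quotientTrdeg ℂ (idealOfSet S)) :=
  rfl

/-- The comorphism of a regular map. -/
noncomputable def comorphism {φ : V → W} (hφ : IsRegularMap φ) :
    regularFunctions W →ₐ[ℂ] regularFunctions V where
  toFun f := ⟨fun v => (f : W → ℂ) (φ v), comp_mem_regularFunctions f.2 hφ⟩
  map_one' := rfl
  map_mul' _ _ := rfl
  map_zero' := rfl
  map_add' _ _ := rfl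
  commutes' _ := rfl

theorem zariskiDim_le_of_closure {S T : Set W}
    (h : ∀ f ∈ regularFunctions W, (∀ w ∈ T, f w = 0) → ∀ w ∈ S, f w = 0) :
    zariskiDim S ≤ zariskiDim T :=
  OrderHomClass.mono Cardinal.toENat (quotientTrdeg_anti fun f hf => h f f.2 hf)

theorem zariskiDim_mono {S T : Set W} (h : S ⊆ T) : zariskiDim S ≤ zariskiDim T :=
  zariskiDim_le_of_closure fun _ _ hf w hw => hf w (h hw)

/-- The comorphism embeds the coordinate ring of the closure of the image into that of the closure
of `S`. -/
theorem zariskiDim_image_le {φ : V → W} (hφ : IsRegularMap φ) (S : Set V) :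
    zariskiDim (φ '' S) ≤ zariskiDim S := by
  have h : idealOfSet (φ '' S) = (idealOfSet S).comap (comorphism hφ) := by
    ext f
    rw [Ideal.mem_comap, mem_idealOfSet, mem_idealOfSet, Set.forall_mem_image]
    rfl
  have := OrderHomClass.mono Cardinal.toENat
    (lift_quotientTrdeg_comap_le (comorphism hφ) (idealOfSet S))
  rw [zariskiDim_eq, zariskiDim_eq, h]
  simpa using this

/-- The functions `l k` are algebraically independent on the set `S`. -/
def AlgIndepOn {κ : Type*} (l : κ → Module.Dual ℂ W) (S : Set W) : Prop :=
  ∀ P : MvPolynomial κ ℂ, (∀ w ∈ S, MvPolynomial.eval (fun k => l k w) P = 0) → P = 0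

/-- A linear form as a regular function. -/
def dualToRegular (l : Module.Dual ℂ W) : regularFunctions W :=
  ⟨fun v => l v, dual_mem_regularFunctions l⟩

theorem aeval_dualToRegular_apply {κ : Type*} (l : κ → Module.Dual ℂ W) (P : MvPolynomial κ ℂ)
    (w : W) : (MvPolynomial.aeval (fun k => dualToRegular (l k)) P : regularFunctions W).1 w =
      MvPolynomial.eval (fun k => l k w) P := by
  rw [← MvPolynomial.coe_aeval_eq_eval]
  exact MvPolynomial.comp_aeval_apply (fun k => dualToRegular (l k))
    ((Pi.evalAlgHom ℂ (fun _ : W => ℂ) w).comp (regularFunctions W).val) P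

theorem aeval_dualToRegular_mem_iff {κ : Type*} {l : κ → Module.Dual ℂ W} {S : Set W}
    {P : MvPolynomial κ ℂ} : MvPolynomial.aeval (fun k => dualToRegular (l k)) P ∈ idealOfSet S ↔
      ∀ w ∈ S, MvPolynomial.eval (fun k => l k w) P = 0 := by
  simp only [mem_idealOfSet, aeval_dualToRegular_apply]

theorem AlgIndepOn.card_le_zariskiDim {κ : Type*} [Fintype κ] {l : κ → Module.Dual ℂ W}
    {S : Set W} (h : AlgIndepOn l S) : (Fintype.card κ : ℕ∞) ≤ zariskiDim S := by
  have := OrderHomClass.mono Cardinal.toENat (natCast_card_le_quotientTrdeg fun P hP =>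
    h P (aeval_dualToRegular_mem_iff.1 hP))
  simpa [zariskiDim_eq] using this

/-- Allows a transcendence basis to be chosen among linear coordinates, whose growth under scaling
can be controlled. -/
theorem adjoin_dualToRegular {κ : Type*} {l : κ → Module.Dual ℂ W}
    (hl : Submodule.span ℂ (Set.range l) = ⊤) :
    Algebra.adjoin ℂ (Set.range fun k => dualToRegular (l k)) = ⊤ := by
  set B := Algebra.adjoin ℂ (Set.range fun k => dualToRegular (l k)) with hB
  have hdual : ∀ m : Module.Dual ℂ W, dualToRegular m ∈ B := fun m => by
    have hm : m ∈ Submodule.span ℂ (Set.range l) := hl ▸ Submodule.mem_top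
    induction hm using Submodule.span_induction with
    | mem x hx => obtain ⟨k, rfl⟩ := hx; exact Algebra.subset_adjoin ⟨k, rfl⟩
    | zero => exact B.zero_mem
    | add x y _ _ hx hy => exact B.add_mem hx hy
    | smul c x _ hx => exact B.smul_mem hx c
  rw [eq_top_iff]
  rintro ⟨f, hf⟩ -
  induction hf using Algebra.adjoin_induction with
  | mem x hx => obtain ⟨m, rfl⟩ := hx; exact hdual m
  | algebraMap r => exact B.algebraMap_mem r
  | add x y _ _ hx hy => exact B.add_mem hx hy
  | mul x y _ _ hx hy => exact B.mul_mem hx hy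

/-- The closure of `S` is an irreducible variety. -/
def IsZariskiIrreducible (S : Set W) : Prop :=
  S.Nonempty ∧ ∀ f ∈ regularFunctions W, ∀ g ∈ regularFunctions W,
    (∀ w ∈ S, f w * g w = 0) → (∀ w ∈ S, f w = 0) ∨ ∀ w ∈ S, g w = 0

theorem IsZariskiIrreducible.isPrime {S : Set W} (hS : IsZariskiIrreducible S) :
    (idealOfSet S).IsPrime where
  ne_top' h := by
    obtain ⟨w, hw⟩ := hS.1
    have h1 := mem_idealOfSet.1 ((Ideal.eq_top_iff_one _).1 h) w hw
    exact one_ne_zero h1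
  mem_or_mem' {f g} h := hS.2 f f.2 g g.2 h

/-- The dimension of an irreducible set is attained by algebraically independent coordinates. -/
theorem IsZariskiIrreducible.exists_algIndepOn {S : Set W} (hS : IsZariskiIrreducible S)
    {κ : Type*} [Fintype κ] {l : κ → Module.Dual ℂ W}
    (hl : Submodule.span ℂ (Set.range l) = ⊤) :
    ∃ J : Finset κ, AlgIndepOn (fun k : J => l k) S ∧ zariskiDim S = J.card := by
  have := hS.isPrime
  obtain ⟨J, hJ, hd⟩ := exists_quotientTrdeg_eq_card (I := idealOfSet S) (adjoin_dualToRegular hl)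
  refine ⟨J, fun P hP => hJ P (aeval_dualToRegular_mem_iff.2 hP), ?_⟩
  rw [zariskiDim_eq, hd]
  simp

end Dimension

/-! ### Images of rational maps with a global denominator -/

section QuotientImage

/-- The image of the rational map `h⁻¹ φ` on the open set `{h ≠ 0}`. -/
def quotientImage {V W : Type*} [AddCommGroup W] [Module ℂ W] (h : V → ℂ) (φ : V → W) : Set W :=
  (fun v => (h v)⁻¹ • φ v) '' {v | h v ≠ 0}

theorem mem_quotientImage {V W : Type*} [AddCommGroup W] [Module ℂ W] {h : V → ℂ} (φ : V → W)
    {v : V} (hv : h v ≠ 0) :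
    (h v)⁻¹ • φ v ∈ quotientImage h φ :=
  ⟨v, hv, rfl⟩

theorem quotientImage_one {V W : Type*} [AddCommGroup W] [Module ℂ W] (φ : V → W) :
    quotientImage 1 φ = Set.range φ := by
  simp [quotientImage]

variable {V W X : Type*} [AddCommGroup V] [Module ℂ V] [AddCommGroup W] [Module ℂ W]
  [AddCommGroup X] [Module ℂ X]

/-- Composing a regular function with `h⁻¹ φ` produces only powers of `h` as denominators. -/
theorem exists_pow_mul_comp_mem_regularFunctions {h : V → ℂ} {φ : V → W}
    (hh : h ∈ regularFunctions V) (hφ : IsRegularMap φ) {f : W → ℂ} (hf : f ∈ regularFunctions W) :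
    ∃ N, ∀ M ≥ N, ∃ r ∈ regularFunctions V,
      ∀ v, h v ≠ 0 → r v = h v ^ M * f ((h v)⁻¹ • φ v) := by
  induction hf using Algebra.adjoin_induction with
  | mem x hx =>
    obtain ⟨l, rfl⟩ := hx
    refine ⟨1, fun M hM => ⟨fun v => h v ^ (M - 1) * l (φ v),
      mul_mem_regularFunctions (pow_mem_regularFunctions hh _) (hφ l), fun v hv => ?_⟩⟩
    obtain ⟨k, rfl⟩ := Nat.exists_eq_add_of_le hM
    simp only [add_tsub_cancel_left, map_smul, smul_eq_mul]
    field_simp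
    ring
  | algebraMap r =>
    exact ⟨0, fun M _ => ⟨fun v => h v ^ M * r,
      mul_mem_regularFunctions (pow_mem_regularFunctions hh _) (const_mem_regularFunctions r),
      fun v _ => rfl⟩⟩
  | add x y _ _ hx hy =>
    obtain ⟨N₁, h₁⟩ := hx
    obtain ⟨N₂, h₂⟩ := hy
    -- All large exponents are allowed, so both summands can be given the same one.
    refine ⟨max N₁ N₂, fun M hM => ?_⟩
    obtain ⟨r₁, hr₁, e₁⟩ := h₁ M (le_trans (le_max_left _ _) hM)
    obtain ⟨r₂, hr₂, e₂⟩ := h₂ M (le_trans (le_max_right _ _) hM)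
    exact ⟨r₁ + r₂, add_mem hr₁ hr₂, fun v hv => by simp [e₁ v hv, e₂ v hv, mul_add]⟩
  | mul x y _ _ hx hy =>
    obtain ⟨N₁, h₁⟩ := hx
    obtain ⟨N₂, h₂⟩ := hy
    refine ⟨N₁ + N₂, fun M hM => ?_⟩
    obtain ⟨k, rfl⟩ := Nat.exists_eq_add_of_le hM
    obtain ⟨r₁, hr₁, e₁⟩ := h₁ N₁ le_rfl
    obtain ⟨r₂, hr₂, e₂⟩ := h₂ (N₂ + k) (by omega)
    exact ⟨r₁ * r₂, mul_mem hr₁ hr₂, fun v hv => by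
      simp only [Pi.mul_apply, e₁ v hv, e₂ v hv]; ring⟩

theorem exists_regularMap_eq_pow_smul_comp [FiniteDimensional ℂ X] {h : V → ℂ} {φ : V → W}
    (hh : h ∈ regularFunctions V) (hφ : IsRegularMap φ) {χ : W → X} (hχ : IsRegularMap χ) :
    ∃ (N : ℕ) (q : V → X), IsRegularMap q ∧
      ∀ v, h v ≠ 0 → q v = h v ^ N • χ ((h v)⁻¹ • φ v) := by
  let b := Module.finBasis ℂ X
  choose N hN using fun k => exists_pow_mul_comp_mem_regularFunctions hh hφ (hχ (b.coord k))
  choose r hr he using fun k => hN k (Finset.univ.sup N) (Finset.le_sup (Finset.mem_univ k))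
  refine ⟨Finset.univ.sup N, fun v => ∑ k, r k v • b k,
    IsRegularMap.sum _ fun k _ => (IsRegularMap.const (b k)).smul (hr k), fun v hv => ?_⟩
  conv_rhs => rw [← b.sum_repr (χ ((h v)⁻¹ • φ v)), Finset.smul_sum]
  refine Finset.sum_congr rfl fun k _ => ?_
  rw [he k v hv, mul_smul]
  rfl

/-- Up to powers of `h`, functions on the image pull back to regular functions on `V`, and these
have no zero divisors. -/
theorem isZariskiIrreducible_quotientImage {h : V → ℂ} {φ : V → W} (hh : h ∈ regularFunctions V)
    (hh0 : ∃ v, h v ≠ 0) (hφ : IsRegularMap φ) : IsZariskiIrreducible (quotientImage h φ) := by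
  refine ⟨hh0.imp' _ fun v hv => mem_quotientImage φ hv, fun f hf g hg H => ?_⟩
  obtain ⟨N₁, h₁⟩ := exists_pow_mul_comp_mem_regularFunctions hh hφ hf
  obtain ⟨N₂, h₂⟩ := exists_pow_mul_comp_mem_regularFunctions hh hφ hg
  obtain ⟨r₁, hr₁, e₁⟩ := h₁ N₁ le_rfl
  obtain ⟨r₂, hr₂, e₂⟩ := h₂ N₂ le_rfl
  by_contra! hc
  obtain ⟨⟨_, ⟨a, ha, rfl⟩, hfa⟩, ⟨_, ⟨b, hb, rfl⟩, hgb⟩⟩ := hc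
  -- The extra factor `h` forces the common nonvanishing point into `{h ≠ 0}`.
  have ha' : h a * r₁ a ≠ 0 := by
    rw [e₁ a ha]
    exact mul_ne_zero ha (mul_ne_zero (pow_ne_zero _ ha) hfa)
  have hb' : r₂ b ≠ 0 := by rw [e₂ b hb]; exact mul_ne_zero (pow_ne_zero _ hb) hgb
  obtain ⟨v, hv₁, hv₂⟩ := exists_mul_ne_zero (mul_mem_regularFunctions hh hr₁) hr₂ ⟨a, ha'⟩ ⟨b, hb'⟩
  have hv := left_ne_zero_of_mul hv₁
  have hv₁ := right_ne_zero_of_mul hv₁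
  rw [e₁ v hv] at hv₁
  rw [e₂ v hv] at hv₂
  exact mul_ne_zero (right_ne_zero_of_mul hv₁) (right_ne_zero_of_mul hv₂)
    (H _ (mem_quotientImage φ hv))

theorem AlgIndepOn.comp_injective {κ κ' : Type*} {l : κ → Module.Dual ℂ W} {S : Set W}
    (h : AlgIndepOn l S) {e : κ' → κ} (he : Function.Injective e) : AlgIndepOn (l ∘ e) S :=
  fun P hP => (MvPolynomial.rename_eq_zero_iff_of_injective P he).1 (h _ fun w hw => by
    rw [MvPolynomial.eval_rename]
    exact hP w hw)

theorem span_range_coord {κ : Type*} [Finite κ] (b : Module.Basis κ ℂ W) :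
    Submodule.span ℂ (Set.range b.coord) = ⊤ := by
  classical
  rw [← b.coe_dualBasis, b.dualBasis.span_eq]

/-- Clearing the denominator of `h⁻¹ φ` raises the dimension by at most one. -/
theorem zariskiDim_range_le_add_one [FiniteDimensional ℂ W] {h : V → ℂ} {φ : V → W}
    (hh : h ∈ regularFunctions V) (hh0 : ∃ v, h v ≠ 0) (hφ : IsRegularMap φ) :
    zariskiDim (Set.range φ) ≤ zariskiDim (quotientImage h φ) + 1 := by
  classical
  -- The square makes `h⁻¹ χ = (h⁻¹ φ, h)`: this records the lost denominator in one extra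
  -- coordinate, and `μ` below multiplies it back to recover `φ`.
  set χ : V → W × ℂ := fun v => (φ v, h v * h v)
  have hχ : IsRegularMap χ := hφ.prodMk (isRegularMap_of_mem (mul_mem_regularFunctions hh hh))
  have hval : ∀ v, h v ≠ 0 → (h v)⁻¹ • χ v = ((h v)⁻¹ • φ v, h v) := fun v hv =>
    Prod.ext rfl (inv_mul_cancel_left₀ hv (h v))
  set μ : W × ℂ → W := fun x => x.2 • x.1
  have hμ : IsRegularMap μ := (IsRegularMap.linearMap (LinearMap.fst ℂ W ℂ)).smul
    (dual_mem_regularFunctions (LinearMap.snd ℂ W ℂ))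
  have h1 : zariskiDim (Set.range φ) ≤ zariskiDim (μ '' quotientImage h χ) := by
    refine zariskiDim_le_of_closure ?_
    rintro f hf H _ ⟨v, rfl⟩
    refine eq_zero_of_forall_ne_zero hh (comp_mem_regularFunctions hf hφ) hh0 (fun u hu => ?_) v
    refine H _ ⟨_, mem_quotientImage χ hu, ?_⟩
    rw [hval u hu]
    simp [μ, hu]
  refine h1.trans ((zariskiDim_image_le hμ _).trans ?_)
  let b := Module.finBasis ℂ W
  obtain ⟨J, hJ, hd⟩ := (isZariskiIrreducible_quotientImage hh hh0 hχ).exists_algIndepOn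
    (span_range_coord (b.prod (Module.Basis.singleton Unit ℂ)))
  -- Discarding the extra coordinate removes at most one element of `J`.
  have hJl : AlgIndepOn (fun k : J.toLeft => b.coord k) (quotientImage h φ) := by
    intro P hP
    refine hJ.comp_injective (e := fun k : J.toLeft => ⟨.inl k, Finset.mem_toLeft.1 k.2⟩)
      (fun k k' hk => Subtype.ext (Sum.inl_injective (congrArg Subtype.val hk))) P ?_
    rintro _ ⟨v, hv, rfl⟩
    have := hP _ (mem_quotientImage φ hv)
    simp only [hval v hv]
    convert this using 3
    exact funext fun k => Module.Basis.prod_repr_inl b (Module.Basis.singleton Unit ℂ)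
      ((h v)⁻¹ • φ v, h v) k.1
  have h2 := hJl.card_le_zariskiDim
  rw [Fintype.card_coe] at h2
  have h3 : J.card ≤ J.toLeft.card + 1 := by
    rw [← Finset.card_toLeft_add_card_toRight (u := J)]
    gcongr
    exact Finset.card_le_univ _
  rw [hd]
  calc (J.card : ℕ∞) ≤ (J.toLeft.card : ℕ∞) + 1 := by exact_mod_cast h3
    _ ≤ _ := by gcongr

end QuotientImage

/-! ### Algebraic independence and limits -/

section Limits

open Filter Topology Bornology

variable {V W : Type*} [AddCommGroup W] [Module ℂ W]

theorem tendsto_zpow_cobounded_zero {n : ℤ} (hn : n < 0) :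
    Tendsto (fun s : ℂ => s ^ n) (cobounded ℂ) (𝓝 0) := by
  obtain ⟨m, rfl⟩ : ∃ m : ℕ, n = -((m : ℤ) + 1) := ⟨(-n - 1).toNat, by omega⟩
  have h := (tendsto_inv₀_cobounded (α := ℂ)).pow (m + 1)
  rw [zero_pow (Nat.succ_ne_zero m)] at h
  refine h.congr fun s => ?_
  rw [inv_pow, zpow_neg]
  norm_cast

theorem zpow_sum₀ {κ : Type*} {s : ℂ} (hs : s ≠ 0) (f : κ → ℤ) (J : Finset κ) :
    s ^ ∑ k ∈ J, f k = ∏ k ∈ J, s ^ f k := by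
  classical
  induction J using Finset.induction_on with
  | empty => simp
  | insert a J ha ih => rw [Finset.sum_insert ha, Finset.prod_insert ha, zpow_add₀ hs, ih]

/-- Algebraic independence on the image of `h'⁻¹ φ'` spreads to the image of `h⁻¹ φ` if the former
map is the limit of rescaled translates of the latter. -/
theorem AlgIndepOn.of_tendsto {κ : Type*} [Fintype κ] {l : κ → Module.Dual ℂ W}
    {h h' : V → ℂ} {φ φ' : V → W} (T : ℂ → V → V) (e : ℕ) (d : κ → ℕ)
    (hh : ∀ v, Tendsto (fun s => (s ^ e)⁻¹ * h (T s v)) (cobounded ℂ) (𝓝 (h' v)))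
    (hφ : ∀ k v, Tendsto (fun s => (s ^ d k)⁻¹ * l k (φ (T s v))) (cobounded ℂ) (𝓝 (l k (φ' v))))
    (hl : AlgIndepOn l (quotientImage h' φ')) : AlgIndepOn l (quotientImage h φ) := by
  classical
  intro P hP
  by_contra hP0
  -- The coordinate `k` of `h⁻¹ φ` along `T s v` is scaled by `s ^ w k`. The part of `P` of largest
  -- weight `D` is nonzero; it will be shown to vanish on the image of `h'⁻¹ φ'`.
  set w : κ → ℤ := fun k => d k - e
  obtain ⟨m₀, hm₀, hmax⟩ := P.support.exists_max_image (Finsupp.weight w)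
    (MvPolynomial.support_nonempty.2 hP0)
  set D := Finsupp.weight w m₀
  have hQ : MvPolynomial.weightedHomogeneousComponent w D P ≠ 0 := fun h0 => by
    have := congrArg (MvPolynomial.coeff m₀) h0
    rw [MvPolynomial.coeff_weightedHomogeneousComponent, if_pos rfl,
      MvPolynomial.coeff_zero] at this
    exact MvPolynomial.mem_support_iff.1 hm₀ this
  refine hQ (hl _ ?_)
  rintro _ ⟨v, hv, rfl⟩
  set x : ℂ → κ → ℂ := fun s k => l k ((h (T s v))⁻¹ • φ (T s v))
  have hx : ∀ k, Tendsto (fun s => s ^ (-w k) * x s k) (cobounded ℂ)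
      (𝓝 (l k ((h' v)⁻¹ • φ' v))) := fun k => by
    have := ((hh v).inv₀ hv).mul (hφ k v)
    rw [map_smul, smul_eq_mul]
    refine this.congr' ?_
    filter_upwards [eventually_ne_cobounded (0 : ℂ)] with s hs
    simp only [x, w, map_smul, smul_eq_mul, neg_sub, zpow_sub₀ hs, zpow_natCast, mul_inv, inv_inv]
    ring
  -- After division by `s ^ D`, monomials of smaller weight tend to 0 and only the top part
  -- survives.
  have hlim : Tendsto (fun s => s ^ (-D) * MvPolynomial.eval (x s) P) (cobounded ℂ)
      (𝓝 (MvPolynomial.eval (fun k => l k ((h' v)⁻¹ • φ' v))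
        (MvPolynomial.weightedHomogeneousComponent w D P))) := by
    rw [MvPolynomial.weightedHomogeneousComponent_apply, map_sum, Finset.sum_filter]
    simp only [MvPolynomial.eval_monomial, Finsupp.prod_fintype _ _ (fun _ => pow_zero _)]
    have hterm : ∀ m ∈ P.support, Tendsto (fun s : ℂ => s ^ (Finsupp.weight w m - D) *
        (P.coeff m * ∏ k, (s ^ (-w k) * x s k) ^ m k)) (cobounded ℂ)
        (𝓝 (if Finsupp.weight w m = D then
          P.coeff m * ∏ k, (l k ((h' v)⁻¹ • φ' v)) ^ m k else 0)) := fun m hm => by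
      have hprod := (tendsto_finsetProd Finset.univ fun k _ => (hx k).pow (m k)).const_mul
        (P.coeff m)
      split_ifs with hD
      · simpa [hD] using hprod
      · have := (tendsto_zpow_cobounded_zero
          (sub_neg.2 (lt_of_le_of_ne (hmax m hm) hD))).mul hprod
        rwa [zero_mul] at this
    refine (tendsto_finsetSum _ hterm).congr' ?_
    filter_upwards [eventually_ne_cobounded (0 : ℂ)] with s hs
    rw [MvPolynomial.eval_eq', Finset.mul_sum]
    refine Finset.sum_congr rfl fun m _ => ?_
    have hw : ∏ k, (s ^ (-w k)) ^ m k = s ^ (-Finsupp.weight w m) := by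
      have hsum : -Finsupp.weight w m = ∑ k, -w k * m k := by
        rw [Finsupp.weight_apply, Finsupp.sum_fintype _ _ (by simp), ← Finset.sum_neg_distrib]
        exact Finset.sum_congr rfl fun k _ => by rw [nsmul_eq_mul]; ring
      rw [hsum, zpow_sum₀ hs]
      exact Finset.prod_congr rfl fun k _ => by rw [zpow_mul, zpow_natCast]
    simp only [mul_pow, Finset.prod_mul_distrib, hw]
    rw [sub_eq_add_neg, zpow_add₀ hs, zpow_neg s (Finsupp.weight w m)]
    field_simp
  -- Since `h' v ≠ 0`, the point `T s v` lies in `{h ≠ 0}` for large `s`, so the relation `P`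
  -- applies there.
  have hzero : ∀ᶠ s in cobounded ℂ, s ^ (-D) * MvPolynomial.eval (x s) P = 0 := by
    filter_upwards [(hh v).eventually_ne hv] with s hs
    rw [hP _ (mem_quotientImage φ (right_ne_zero_of_mul hs)), mul_zero]
  exact tendsto_nhds_unique_of_eventuallyEq hlim tendsto_const_nhds hzero

end Limits

/-! ### Leading terms in one summand -/

section LeadingTerm

open Filter Topology Bornology

variable {ι : Type*} [DecidableEq ι] {V : ι → Type*} [∀ i, AddCommGroup (V i)]
  [∀ i, Module ℂ (V i)] {M : Type*} [AddCommGroup M] [Module ℂ M]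

theorem scaleAt_one (i : ι) (v : ∀ i, V i) : scaleAt i 1 v = v := by
  simp [scaleAt]

theorem scaleAt_scaleAt (i : ι) (s t : ℂ) (v : ∀ i, V i) :
    scaleAt i s (scaleAt i t v) = scaleAt i (s * t) v := by
  simp [scaleAt, mul_smul]

theorem scaleAt_apply (i k : ι) (s : ℂ) (v : ∀ i, V i) :
    scaleAt i s v k = (if k = i then s else 1) • v k := by
  rcases eq_or_ne k i with rfl | hk
  · simp [scaleAt]
  · simp [scaleAt, hk]

theorem scaleAt_comm (i k : ι) (s t : ℂ) (v : ∀ i, V i) :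
    scaleAt i s (scaleAt k t v) = scaleAt k t (scaleAt i s v) := by
  ext j
  simp only [scaleAt_apply]
  rw [smul_comm]

theorem piRep_scaleAt {G : Type*} [Group G] (ρ : ∀ i, Representation ℂ G (V i)) (g : G) (i : ι)
    (s : ℂ) (v : ∀ i, V i) : piRep ρ g (scaleAt i s v) = scaleAt i s (piRep ρ g v) := by
  ext j
  have h : ∀ w : ∀ i, V i, piRep ρ g w j = ρ j g (w j) := fun _ => rfl
  rw [h, scaleAt_apply, scaleAt_apply, map_smul, h]

/-- A vector valued polynomial function with only zero values has zero coefficients. -/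
theorem eq_zero_of_forall_sum_pow_smul_eq_zero {n : ℕ} {c : ℕ → M}
    (h : ∀ s : ℂ, ∑ k ∈ Finset.range n, s ^ k • c k = 0) {k : ℕ} (hk : k < n) : c k = 0 := by
  rw [← Module.forall_dual_apply_eq_zero_iff ℂ]
  intro l
  have hP : ∑ k ∈ Finset.range n, Polynomial.monomial k (l (c k)) = 0 :=
    Polynomial.funext fun s => by
      have := congrArg l (h s)
      simpa [Polynomial.eval_finsetSum, mul_comm] using this
  have := congrArg (fun P => Polynomial.coeff P k) hP
  simpa [Polynomial.finsetSum_coeff, Polynomial.coeff_monomial, hk] using this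

theorem eq_of_forall_sum_pow_smul_eq {n : ℕ} {c d : ℕ → M}
    (h : ∀ s : ℂ, ∑ k ∈ Finset.range n, s ^ k • c k = ∑ k ∈ Finset.range n, s ^ k • d k)
    {k : ℕ} (hk : k < n) : c k = d k := by
  rw [← sub_eq_zero]
  refine eq_zero_of_forall_sum_pow_smul_eq_zero (c := fun k => c k - d k) (fun s => ?_) hk
  simp [smul_sub, h s]

theorem exists_polynomial_scaleAt (i : ι) {f : (∀ i, V i) → ℂ}
    (hf : f ∈ regularFunctions (∀ i, V i)) :
    ∃ P : Polynomial (regularFunctions (∀ i, V i)), ∀ s v,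
      f (scaleAt i s v) =
        P.eval₂ ((Pi.evalRingHom (fun _ : ∀ i, V i => ℂ) v).comp
          (regularFunctions (∀ i, V i)).val.toRingHom) s := by
  induction hf using Algebra.adjoin_induction with
  | mem x hx =>
    obtain ⟨l, rfl⟩ := hx
    let p := LinearMap.single ℂ V i ∘ₗ LinearMap.proj i
    refine ⟨.C ⟨_, dual_mem_regularFunctions (l ∘ₗ (LinearMap.id - p))⟩ +
      .C ⟨_, dual_mem_regularFunctions (l ∘ₗ p)⟩ * .X, fun s v => ?_⟩
    have hv : scaleAt i s v = (v - p v) + s • p v := by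
      ext j
      rcases eq_or_ne j i with rfl | hj
      · simp [scaleAt, p]
      · simp [scaleAt, p, hj]
    change l (scaleAt i s v) = _
    rw [hv, map_add, map_smul, smul_eq_mul, mul_comm]
    simp only [Polynomial.eval₂_add, Polynomial.eval₂_mul, Polynomial.eval₂_C, Polynomial.eval₂_X]
    rfl
  | algebraMap r =>
    refine ⟨.C (algebraMap ℂ _ r), fun s v => ?_⟩
    rw [Polynomial.eval₂_C]
    rfl
  | add x y _ _ hx hy =>
    obtain ⟨P, hP⟩ := hx
    obtain ⟨Q, hQ⟩ := hy
    exact ⟨P + Q, fun s v => by rw [Polynomial.eval₂_add, ← hP, ← hQ]; rfl⟩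
  | mul x y _ _ hx hy =>
    obtain ⟨P, hP⟩ := hx
    obtain ⟨Q, hQ⟩ := hy
    exact ⟨P * Q, fun s v => by rw [Polynomial.eval₂_mul, ← hP, ← hQ]; rfl⟩

theorem exists_sum_pow_smul_eq_scaleAt [FiniteDimensional ℂ M] (i : ι) {f : (∀ i, V i) → M}
    (hf : IsRegularMap f) :
    ∃ (n : ℕ) (c : ℕ → (∀ i, V i) → M), (∀ k, IsRegularMap (c k)) ∧
      ∀ s v, f (scaleAt i s v) = ∑ k ∈ Finset.range n, s ^ k • c k v := by
  let b := Module.finBasis ℂ M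
  choose P hP using fun j => exists_polynomial_scaleAt i (hf (b.coord j))
  refine ⟨Finset.univ.sup (fun j => (P j).natDegree) + 1,
    fun k v => ∑ j, ((P j).coeff k : (∀ i, V i) → ℂ) v • b j, fun k => IsRegularMap.sum _ fun j _ =>
      (IsRegularMap.const (b j)).smul ((P j).coeff k).2, fun s v => ?_⟩
  rw [← b.sum_repr (f (scaleAt i s v))]
  simp only [Finset.smul_sum]
  rw [Finset.sum_comm]
  refine Finset.sum_congr rfl fun j _ => ?_
  have h := hP j s v
  rw [Polynomial.eval₂_eq_sum_range' _ (Nat.lt_succ_of_le (Finset.le_sup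
    (f := fun j => (P j).natDegree) (Finset.mem_univ j)))] at h
  rw [Module.Basis.coord_apply] at h
  rw [h, Finset.sum_smul]
  refine Finset.sum_congr rfl fun k _ => ?_
  rw [mul_comm, mul_smul]
  rfl

/-- `f'` is the (nonzero) leading coefficient, of degree `d`, of the polynomial function
`s ↦ f (v₁, …, s vᵢ, …, vₙ)`. -/
structure IsLeadingTerm (i : ι) (d : ℕ) (f f' : (∀ i, V i) → M) : Prop where
  regular : IsRegularMap f'
  exists_ne_zero : ∃ v, f' v ≠ 0
  exists_sum : ∃ c : ℕ → (∀ i, V i) → M, c d = f' ∧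
    ∀ s v, f (scaleAt i s v) = ∑ k ∈ Finset.range (d + 1), s ^ k • c k v

/-- In an expansion with the fewest terms the top coefficient is not identically zero, since
otherwise it could be dropped. -/
theorem exists_isLeadingTerm [FiniteDimensional ℂ M] (i : ι) {f : (∀ i, V i) → M}
    (hf : IsRegularMap f) (h0 : ∃ v, f v ≠ 0) : ∃ d f', IsLeadingTerm i d f f' := by
  classical
  have hex := exists_sum_pow_smul_eq_scaleAt i hf
  obtain ⟨c, hc, hs⟩ := Nat.find_spec hex
  obtain ⟨v₀, hv₀⟩ := h0
  obtain ⟨d, hd⟩ : ∃ d, Nat.find hex = d + 1 := Nat.exists_eq_succ_of_ne_zero fun h => hv₀ <| by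
    have := hs 1 v₀
    rwa [scaleAt_one, h, Finset.sum_range_zero] at this
  rw [hd] at hs
  refine ⟨d, c d, hc d, ?_, c, rfl, hs⟩
  by_contra! h
  refine Nat.find_min hex (m := d) (by omega) ⟨c, hc, fun s v => ?_⟩
  rw [hs, Finset.sum_range_succ, h, smul_zero, add_zero]

namespace IsLeadingTerm

variable {i : ι} {d : ℕ} {f f' : (∀ i, V i) → M}

/-- Compare coefficients of `s ^ d`. With `A` the action of `g` this transfers equivariance; with
`A` a scaling it transfers homogeneity in another summand. -/
theorem map_eq (hf : IsLeadingTerm i d f f') {A : (∀ i, V i) → ∀ i, V i} {B : M →ₗ[ℂ] M}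
    (hA : ∀ s v, A (scaleAt i s v) = scaleAt i s (A v)) (hAB : ∀ v, f (A v) = B (f v))
    (v : ∀ i, V i) : f' (A v) = B (f' v) := by
  obtain ⟨c, rfl, hc⟩ := hf.exists_sum
  refine eq_of_forall_sum_pow_smul_eq (n := d + 1) (c := fun k => c k (A v))
    (d := fun k => B (c k v)) (fun s => ?_) (Nat.lt_succ_self d)
  rw [← hc, ← hA, hAB, hc, map_sum]
  simp only [map_smul]

theorem scaleAt_eq (hf : IsLeadingTerm i d f f') (t : ℂ) (v : ∀ i, V i) :
    f' (scaleAt i t v) = t ^ d • f' v := by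
  obtain ⟨c, rfl, hc⟩ := hf.exists_sum
  refine eq_of_forall_sum_pow_smul_eq (n := d + 1) (c := fun k => c k (scaleAt i t v))
    (d := fun k => t ^ k • c k v) (fun s => ?_) (Nat.lt_succ_self d)
  rw [← hc, scaleAt_scaleAt, hc]
  simp only [mul_pow, mul_smul]

theorem tendsto (hf : IsLeadingTerm i d f f') (l : Module.Dual ℂ M) (v : ∀ i, V i) :
    Tendsto (fun s => (s ^ d)⁻¹ * l (f (scaleAt i s v))) (cobounded ℂ) (𝓝 (l (f' v))) := by
  obtain ⟨c, rfl, hc⟩ := hf.exists_sum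
  have hlim : Tendsto
      (fun s : ℂ => (∑ k ∈ Finset.range d, s ^ ((k : ℤ) - d) * l (c k v)) + l (c d v))
      (cobounded ℂ) (𝓝 (l (c d v))) := by
    have h := tendsto_finsetSum (Finset.range d) fun k hk =>
      (tendsto_zpow_cobounded_zero (n := (k : ℤ) - d)
        (by have := Finset.mem_range.1 hk; omega)).mul_const (l (c k v))
    simpa using h.add_const (l (c d v))
  refine hlim.congr' ?_
  filter_upwards [eventually_ne_cobounded (0 : ℂ)] with s hs
  rw [hc, Finset.sum_range_succ, map_add, mul_add, map_sum, Finset.mul_sum, map_smul, smul_eq_mul,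
    inv_mul_cancel_left₀ (pow_ne_zero d hs)]
  congr 1
  refine Finset.sum_congr rfl fun k _ => ?_
  rw [map_smul, smul_eq_mul, zpow_sub₀ hs, zpow_natCast, zpow_natCast]
  ring

end IsLeadingTerm

/-- Keeps the denominator of a regular covariant equal to 1. -/
theorem isLeadingTerm_one (i : ι) : IsLeadingTerm i 0 (1 : (∀ i, V i) → ℂ) 1 :=
  ⟨IsRegularMap.const 1, ⟨0, one_ne_zero⟩, fun _ => 1, rfl, fun s v => by simp⟩

end LeadingTerm

/-! ### Invariant denominators and compression -/

section Reduction

variable {G : Type*} [Group G]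

/-- A nonzero invariant `h` and a covariant `φ`, that is, the rational covariant `h⁻¹ φ`. -/
structure IsCovariantQuotient {V W : Type*} [AddCommGroup V] [Module ℂ V] [AddCommGroup W]
    [Module ℂ W] (ρ : Representation ℂ G V) (σ : Representation ℂ G W) (h : V → ℂ) (φ : V → W) :
    Prop where
  mem : h ∈ regularFunctions V
  exists_ne_zero : ∃ v, h v ≠ 0
  invariant : ∀ g v, h (ρ g v) = h v
  covariant : IsCovariant ρ σ φ

variable {V W : Type*} [AddCommGroup V] [Module ℂ V] [AddCommGroup W] [Module ℂ W]

/-- A local expression at one point is enough once its denominator is multiplied by a function whose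
nonvanishing locus lies in the domain. -/
theorem RationalMap.exists_eq_inv_smul (ψ : RationalMap V W) :
    ∃ f ∈ regularFunctions V, ∃ p : V → W, IsRegularMap p ∧ (∃ v, f v ≠ 0) ∧
      ∀ v, f v ≠ 0 → ∃ hv : v ∈ ψ.dom, ψ.toFun ⟨v, hv⟩ = (f v)⁻¹ • p v := by
  obtain ⟨u, hu⟩ := ψ.nonempty_dom
  obtain ⟨p, f₁, hp, hf₁, hfu, hψ⟩ := ψ.regular ⟨u, hu⟩
  obtain ⟨f₂, hf₂, hfu₂, hdom⟩ := ψ.isOpen_dom u hu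
  refine ⟨fun v => f₁ v * f₂ v, mul_mem_regularFunctions hf₁ hf₂, fun v => f₂ v • p v,
    hp.smul hf₂, ⟨u, mul_ne_zero hfu hfu₂⟩, fun v hv => ?_⟩
  refine ⟨hdom v (right_ne_zero_of_mul hv), ?_⟩
  rw [hψ ⟨v, _⟩ (left_ne_zero_of_mul hv), smul_smul, mul_inv, inv_mul_cancel_right₀
    (right_ne_zero_of_mul hv)]

variable [Finite G]

/-- A rational covariant is a quotient of a covariant by an invariant. -/
theorem IsFaithfulRationalCovariant.exists_isCovariantQuotient {ρ : Representation ℂ G V}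
    {σ : Representation ℂ G W} {ψ : RationalMap V W} (hψ : IsFaithfulRationalCovariant ρ σ ψ) :
    ∃ h φ, IsCovariantQuotient ρ σ h φ ∧ ActsFaithfullyOn σ (Set.range φ) ∧
      quotientImage h φ ⊆ Set.range ψ.toFun := by
  classical
  have := Fintype.ofFinite G
  obtain ⟨f, hf, p, hp, ⟨u, hu⟩, hfp⟩ := ψ.exists_eq_inv_smul
  -- The norm of `f` is an invariant denominator; the remaining factors `r` go into the numerator.
  set h : V → ℂ := fun v => ∏ g : G, f (ρ g v)
  have hfg : ∀ g : G, (fun v => f (ρ g v)) ∈ regularFunctions V := fun g =>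
    comp_mem_regularFunctions hf (.linearMap (ρ g))
  have hh : h ∈ regularFunctions V := prod_mem_regularFunctions _ fun g _ => hfg g
  have hh0 : ∃ v, h v ≠ 0 := by
    obtain ⟨v, hv⟩ := exists_forall_ne_zero Finset.univ (fun g _ => hfg g)
      (fun g _ => ⟨ρ g⁻¹ u, by simpa using hu⟩)
    exact ⟨v, Finset.prod_ne_zero_iff.2 hv⟩
  have hinv : ∀ g v, h (ρ g v) = h v := fun g v =>
    Fintype.prod_equiv (Equiv.mulRight g) _ _ fun k => by simp
  set r : V → ℂ := fun v => ∏ g ∈ Finset.univ.erase (1 : G), f (ρ g v)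
  have hr : r ∈ regularFunctions V := prod_mem_regularFunctions _ fun g _ => hfg g
  have hhr : ∀ v, h v = f v * r v := fun v => by
    simpa using (Finset.mul_prod_erase Finset.univ (fun g : G => f (ρ g v))
      (Finset.mem_univ 1)).symm
  set φ : V → W := fun v => r v • p v
  have hφ : IsRegularMap φ := hp.smul hr
  have hval : ∀ v, h v ≠ 0 → ∃ hv : v ∈ ψ.dom, ψ.toFun ⟨v, hv⟩ = (h v)⁻¹ • φ v := fun v hv => by
    rw [hhr] at hv
    obtain ⟨hv', e⟩ := hfp v (left_ne_zero_of_mul hv)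
    refine ⟨hv', ?_⟩
    rw [e, hhr, smul_smul, mul_inv, inv_mul_cancel_right₀ (right_ne_zero_of_mul hv)]
  refine ⟨h, φ, ⟨hh, hh0, hinv, hφ, fun g => ?_⟩, fun g hg => ?_, ?_⟩
  · refine IsRegularMap.eq_of_forall_ne_zero hh (hφ.comp (.linearMap (ρ g)))
      ((IsRegularMap.linearMap (σ g)).comp hφ) hh0 fun v hv => ?_
    obtain ⟨h₁, e₁⟩ := hval v hv
    obtain ⟨h₂, e₂⟩ := hval (ρ g v) (by rwa [hinv])
    have e := hψ.1 g ⟨v, h₁⟩ ⟨ρ g v, h₂⟩ rfl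
    rw [e₁, e₂, hinv, map_smul] at e
    exact smul_right_injective W (inv_ne_zero hv) e
  · refine hψ.2 g ?_
    rintro _ ⟨v, rfl⟩
    -- The domain of `ψ` may exceed `{h ≠ 0}`, so triviality of `g` is carried to `v` by density
    -- through a local expression there.
    obtain ⟨q, k, hq, hk, hkv, e⟩ := ψ.regular v
    obtain ⟨w, hw⟩ := exists_mul_ne_zero hk hh ⟨v, hkv⟩ hh0
    have hgq : σ g (q v) = q v := by
      refine IsRegularMap.eq_of_forall_ne_zero (mul_mem_regularFunctions hk hh)
        ((IsRegularMap.linearMap (σ g)).comp hq) hq ⟨w, mul_ne_zero hw.1 hw.2⟩ (fun x hx => ?_) v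
      obtain ⟨hx', ex⟩ := hval x (right_ne_zero_of_mul hx)
      have ex' := e ⟨x, hx'⟩ (left_ne_zero_of_mul hx)
      have : q x = k x • (h x)⁻¹ • φ x := by
        rw [← ex, ex', smul_inv_smul₀ (left_ne_zero_of_mul hx)]
      rw [this, map_smul, map_smul, hg _ ⟨x, rfl⟩]
    rw [e v hkv, map_smul, hgq]
  · rintro _ ⟨v, hv, rfl⟩
    obtain ⟨hv', e⟩ := hval v hv
    exact ⟨⟨v, hv'⟩, e⟩

/-- A faithful rational covariant may be compressed to one between given modules, the source being
faithful, whose numerator takes a nonzero multiple of a given value. -/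
theorem IsCovariantQuotient.exists_compression {V₀ W₀ : Type*} [AddCommGroup V₀] [Module ℂ V₀]
    [AddCommGroup W₀] [Module ℂ W₀] [FiniteDimensional ℂ W] {ρ₀ : Representation ℂ G V₀}
    {σ₀ : Representation ℂ G W₀} {h : V₀ → ℂ} {φ : V₀ → W₀}
    (hφ : IsCovariantQuotient ρ₀ σ₀ h φ) (hf : ActsFaithfullyOn σ₀ (Set.range φ))
    {ρ : Representation ℂ G V} (σ : Representation ℂ G W) (hρ : Function.Injective ρ) (w : W) :
    ∃ h' φ', IsCovariantQuotient ρ σ h' φ' ∧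
      zariskiDim (quotientImage h' φ') ≤ zariskiDim (quotientImage h φ) ∧
      (h = 1 → h' = 1) ∧ ∃ v, ∃ c : ℂ, c ≠ 0 ∧ φ' v = c • w := by
  obtain ⟨x, hx, hhx⟩ := exists_forall_ne_of_faithful σ₀ hφ.covariant.1
    (χ := fun _ : Unit => h) (fun _ => isRegularMap_of_mem hφ.mem) (fun _ => hφ.exists_ne_zero) hf
  have hhx : h x ≠ 0 := hhx ()
  have hx' : ∀ g : G, g ≠ 1 → ρ₀ g x ≠ x := fun g hg e => hx g hg (by rw [← hφ.covariant.2, e])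
  obtain ⟨v, hv, -⟩ : ∃ v, (∀ g : G, g ≠ 1 → ρ g v ≠ v) ∧ _ :=
    exists_forall_ne_of_faithful ρ (IsRegularMap.linearMap LinearMap.id)
    (ι := Empty) (Y := fun _ => ℂ) (χ := fun e => e.elim) (fun e => e.elim) (fun e => e.elim)
    (fun g hg => hρ (by
      rw [map_one]
      ext u
      exact hg u ⟨u, rfl⟩))
  -- The compression is `μ ∘ (h⁻¹ φ) ∘ ν`, sending `v` to `x`, then to `(h x)⁻¹ • φ x`, then to `w`.
  obtain ⟨ν, hν, hνv⟩ := exists_covariant_apply_eq ρ ρ₀ hv x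
  obtain ⟨μ, hμ, hμw⟩ := exists_covariant_apply_eq σ₀ σ (v := (h x)⁻¹ • φ x) (fun g hg e =>
    hx g hg (smul_right_injective W₀ (inv_ne_zero hhx) (by rwa [map_smul] at e))) w
  have hk := comp_mem_regularFunctions hφ.mem hν.1
  obtain ⟨N, q, hq, hqv⟩ := exists_regularMap_eq_pow_smul_comp hk (hφ.covariant.1.comp hν.1) hμ.1
  have hinv : ∀ g u, h (ν (ρ g u)) = h (ν u) := fun g u => by rw [hν.2, hφ.invariant]
  -- The exponent `N` clears the denominator. One more factor makes the numerator vanish where `h (ν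
  -- u) = 0`, where nothing is known about `q`, so that equivariance holds there too.
  have hval : ∀ u, h (ν u) ≠ 0 → (h (ν u) ^ (N + 1))⁻¹ • h (ν u) • q u =
      μ ((h (ν u))⁻¹ • φ (ν u)) := fun u hu => by
    rw [hqv u hu, smul_smul (h (ν u)), ← pow_succ', inv_smul_smul₀ (pow_ne_zero _ hu)]
  refine ⟨fun u => h (ν u) ^ (N + 1), fun u => h (ν u) • q u, ⟨pow_mem_regularFunctions hk _,
    ⟨v, pow_ne_zero _ (by rwa [hνv])⟩, fun g u => by rw [hinv], hq.smul hk, fun g u => ?_⟩, ?_,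
    ?_, v, h x ^ (N + 1), pow_ne_zero _ hhx, ?_⟩
  · change h (ν (ρ g u)) • q (ρ g u) = σ g (h (ν u) • q u)
    rw [hinv, map_smul]
    rcases eq_or_ne (h (ν u)) 0 with h0 | h0
    · simp [h0]
    · rw [hqv u h0, hqv _ (by rwa [hinv]), hinv, map_smul, ← hμ.2, hν.2, hφ.covariant.2, map_smul]
  · refine le_trans (zariskiDim_mono ?_) (zariskiDim_image_le hμ.1 _)
    rintro _ ⟨u, hu, rfl⟩
    have hu : h (ν u) ≠ 0 := fun h0 => hu (by simp [h0])
    exact ⟨_, mem_quotientImage φ hu, (hval u hu).symm⟩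
  · rintro rfl
    ext u
    simp
  · change h (ν v) • q v = _
    rw [hqv v (by rwa [hνv]), hνv, hμw, smul_smul, pow_succ']

end Reduction

/-! ### Making quotients multihomogeneous -/

section Homogenization

variable {G : Type*} [Group G] {ι κ : Type*} [DecidableEq ι] [Fintype κ]
  {V : ι → Type*} {W : κ → Type*} [∀ i, AddCommGroup (V i)] [∀ i, Module ℂ (V i)]
  [∀ j, AddCommGroup (W j)] [∀ j, Module ℂ (W j)]

/-- `f (v₁, …, t vᵢ, …, vₙ) = t ^ d • f (v₁, …, vₙ)`. -/
def IsHomogeneousIn {ι : Type*} [DecidableEq ι] {V : ι → Type*} [∀ i, AddCommGroup (V i)]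
    [∀ i, Module ℂ (V i)] {M : Type*} [AddCommGroup M] [Module ℂ M] (i : ι) (d : ℕ)
    (f : (∀ i, V i) → M) : Prop :=
  ∀ (t : ℂ) v, f (scaleAt i t v) = t ^ d • f v

theorem IsLeadingTerm.isHomogeneousIn {M : Type*} [AddCommGroup M] [Module ℂ M] {i k : ι}
    {d a : ℕ} {f f' : (∀ i, V i) → M} (hf : IsLeadingTerm i d f f') (h : IsHomogeneousIn k a f) :
    IsHomogeneousIn k a f' := fun t v =>
  hf.map_eq (A := scaleAt k t) (B := t ^ a • LinearMap.id) (fun _ _ => scaleAt_comm _ _ _ _ _)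
    (fun v => h t v) v

/-- Leading terms do not increase the dimension. -/
theorem zariskiDim_quotientImage_leadingTerm_le [∀ j, FiniteDimensional ℂ (W j)] {i : ι} {e : ℕ}
    {d : κ → ℕ} {h h' : (∀ i, V i) → ℂ} {φ φ' : (∀ i, V i) → ∀ j, W j}
    (hh : IsLeadingTerm i e h h')
    (hφ : ∀ j, IsLeadingTerm i (d j) (fun v => φ v j) fun v => φ' v j) :
    zariskiDim (quotientImage h' φ') ≤ zariskiDim (quotientImage h φ) := by
  classical
  let b := Pi.basis fun j => Module.finBasis ℂ (W j)
  obtain ⟨J, hJ, hd⟩ := (isZariskiIrreducible_quotientImage (hh.regular LinearMap.id)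
    hh.exists_ne_zero (IsRegularMap.pi fun j => (hφ j).regular)).exists_algIndepOn
    (span_range_coord b)
  have := hJ.of_tendsto (h := h) (φ := φ) (scaleAt i) e (fun k => d k.1.1)
    (fun v => hh.tendsto LinearMap.id v) (fun k v => ?_)
  · refine hd.trans_le ?_
    simpa using this.card_le_zariskiDim
  · have hb : ∀ w : ∀ j, W j, b.coord k w = (Module.finBasis ℂ (W k.1.1)).coord k.1.2 (w k.1.1) :=
      fun w =>
      Pi.basis_repr (fun j => Module.finBasis ℂ (W j)) w k.1
    simp only [hb]
    exact (hφ k.1.1).tendsto _ v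

/-- All components of a rational covariant may be made homogeneous with respect to finitely many
of the summands of the source. -/
theorem IsCovariantQuotient.exists_isHomogeneousIn [∀ j, FiniteDimensional ℂ (W j)]
    {ρ : ∀ i, Representation ℂ G (V i)} {σ : ∀ j, Representation ℂ G (W j)}
    {h : (∀ i, V i) → ℂ} {φ : (∀ i, V i) → ∀ j, W j}
    (hφ : IsCovariantQuotient (piRep ρ) (piRep σ) h φ) (h0 : ∀ j, ∃ v, φ v j ≠ 0) (I : Finset ι) :
    ∃ h' φ', IsCovariantQuotient (piRep ρ) (piRep σ) h' φ' ∧ (∀ j, ∃ v, φ' v j ≠ 0) ∧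
      zariskiDim (quotientImage h' φ') ≤ zariskiDim (quotientImage h φ) ∧ (h = 1 → h' = 1) ∧
      ∀ i ∈ I, (∃ e, IsHomogeneousIn i e h') ∧
        ∀ j, ∃ d, IsHomogeneousIn i d fun v => φ' v j := by
  induction I using Finset.induction_on with
  | empty => exact ⟨h, φ, hφ, h0, le_rfl, id, by simp⟩
  | insert i I _ ih =>
    obtain ⟨h₁, φ₁, hφ₁, h0₁, hd₁, hone₁, hI⟩ := ih
    -- The denominator 1 is treated separately so that it visibly stays 1.
    have hlead : ∃ e h', IsLeadingTerm i e h₁ h' ∧ (h₁ = 1 → h' = 1) := by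
      by_cases h1 : h₁ = 1
      · exact ⟨0, 1, by rw [h1]; exact isLeadingTerm_one i, fun _ => rfl⟩
      · obtain ⟨e, h', hh'⟩ := exists_isLeadingTerm i (isRegularMap_of_mem hφ₁.mem)
          hφ₁.exists_ne_zero
        exact ⟨e, h', hh', fun h2 => (h1 h2).elim⟩
    obtain ⟨e, h', hh', hone⟩ := hlead
    choose d φ' hφ' using fun j => exists_isLeadingTerm i (hφ₁.covariant.1.apply j) (h0₁ j)
    refine ⟨h', fun v j => φ' j v, ⟨hh'.regular LinearMap.id, hh'.exists_ne_zero, fun g v => ?_,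
      IsRegularMap.pi fun j => (hφ' j).regular, fun g v => ?_⟩, fun j => (hφ' j).exists_ne_zero,
      (zariskiDim_quotientImage_leadingTerm_le hh' hφ').trans hd₁, hone ∘ hone₁, ?_⟩
    · exact hh'.map_eq (A := piRep ρ g) (B := LinearMap.id) (fun _ _ => piRep_scaleAt _ _ _ _ _)
        (fun v => hφ₁.invariant g v) v
    · funext j
      exact (hφ' j).map_eq (A := piRep ρ g) (B := σ j g) (fun _ _ => piRep_scaleAt _ _ _ _ _)
        (fun v => congrFun (hφ₁.covariant.2 g v) j) v
    · intro k hk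
      rcases Finset.mem_insert.1 hk with rfl | hk
      · exact ⟨⟨e, hh'.scaleAt_eq⟩, fun j => ⟨d j, (hφ' j).scaleAt_eq⟩⟩
      · exact ⟨(hI k hk).1.imp fun _ h2 => hh'.isHomogeneousIn h2,
          fun j => ((hI k hk).2 j).imp fun _ h2 => (hφ' j).isHomogeneousIn h2⟩

end Homogenization

/-! ### Automatic faithfulness -/

section Faithful

variable {G : Type*} [Group G]

/-- An element acting trivially on the image of a nonzero covariant to an irreducible module acts
trivially. -/
theorem eq_one_of_forall_apply_eq {V W : Type*} [AddCommGroup V] [Module ℂ V] [AddCommGroup W]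
    [Module ℂ W] {ρ : Representation ℂ G V} {σ : Representation ℂ G W} (hσ : σ.IsIrreducible)
    {φ : V → W} (hφ : ∀ g v, φ (ρ g v) = σ g (φ v)) (h0 : ∃ v, φ v ≠ 0) {g : G}
    (hg : ∀ v, σ g (φ v) = φ v) : σ g = 1 := by
  -- The span of the image is a nonzero subrepresentation, hence everything.
  let S : Subrepresentation σ :=
    { toSubmodule := Submodule.span ℂ (Set.range φ)
      apply_mem_toSubmodule := fun k w hw => by
        induction hw using Submodule.span_induction with
        | mem x hx =>
          obtain ⟨v, rfl⟩ := hx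
          exact Submodule.subset_span ⟨ρ k v, hφ k v⟩
        | zero => simp
        | add x y _ _ hx hy => rw [map_add]; exact add_mem hx hy
        | smul c x _ hx => rw [map_smul]; exact Submodule.smul_mem _ c hx }
  have hS : S = ⊤ := by
    refine (hσ.eq_bot_or_eq_top S).resolve_left fun hbot => ?_
    obtain ⟨v, hv⟩ := h0
    have hmem : φ v ∈ S.toSubmodule := Submodule.subset_span ⟨v, rfl⟩
    rw [hbot] at hmem
    exact hv hmem
  have hS' : Submodule.span ℂ (Set.range φ) = ⊤ := congrArg Subrepresentation.toSubmodule hS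
  refine LinearMap.ext_on hS' ?_
  rintro _ ⟨v, rfl⟩
  exact hg v

theorem actsFaithfullyOn_range_of_forall_exists_ne_zero {κ V : Type*} {W : κ → Type*}
    [AddCommGroup V] [Module ℂ V] [∀ j, AddCommGroup (W j)] [∀ j, Module ℂ (W j)]
    {ρ : Representation ℂ G V} {σ : ∀ j, Representation ℂ G (W j)}
    (hσ : ∀ j, (σ j).IsIrreducible) (hW : Function.Injective (piRep σ)) {φ : V → ∀ j, W j}
    (hφ : IsCovariant ρ (piRep σ) φ) (h0 : ∀ j, ∃ v, φ v j ≠ 0) :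
    ActsFaithfullyOn (piRep σ) (Set.range φ) := by
  intro g hg
  apply hW
  rw [map_one]
  refine LinearMap.ext fun w => funext fun j => ?_
  have := eq_one_of_forall_apply_eq (hσ j) (φ := fun v => φ v j)
    (fun g v => congrFun (hφ.2 g v) j) (h0 j) (g := g) (fun v => congrFun (hg _ ⟨v, rfl⟩) j)
  exact LinearMap.congr_fun this (w j)

theorem actsFaithfullyOn_quotientImage {V W : Type*} [AddCommGroup V] [Module ℂ V]
    [AddCommGroup W] [Module ℂ W] {σ : Representation ℂ G W} {h : V → ℂ} {φ : V → W}
    (hh : h ∈ regularFunctions V) (hh0 : ∃ v, h v ≠ 0) (hφ : IsRegularMap φ)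
    (hf : ActsFaithfullyOn σ (Set.range φ)) : ActsFaithfullyOn σ (quotientImage h φ) := by
  intro g hg
  refine hf g ?_
  rintro _ ⟨v, rfl⟩
  refine IsRegularMap.eq_of_forall_ne_zero hh ((IsRegularMap.linearMap (σ g)).comp hφ) hφ hh0
    (fun u hu => ?_) v
  have := hg _ (mem_quotientImage φ hu)
  rw [map_smul] at this
  exact smul_right_injective W (inv_ne_zero hu) this

end Faithful

/-! ### Quotients as rational maps -/

section RationalQuotient

variable {V W : Type*} [AddCommGroup V] [Module ℂ V] [AddCommGroup W] [Module ℂ W]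

/-- The rational map `h⁻¹ φ`, defined on `{h ≠ 0}`. -/
noncomputable def RationalMap.ofQuotient (h : V → ℂ) (φ : V → W) (hh : h ∈ regularFunctions V)
    (hh0 : ∃ v, h v ≠ 0) (hφ : IsRegularMap φ) : RationalMap V W where
  dom := {v | h v ≠ 0}
  toFun v := (h v)⁻¹ • φ v
  isOpen_dom _ hu := ⟨h, hh, hu, fun _ => id⟩
  nonempty_dom := hh0
  regular u := ⟨φ, h, hφ, hh, u.2, fun _ _ => rfl⟩

variable {h : V → ℂ} {φ : V → W} (hh : h ∈ regularFunctions V) (hh0 : ∃ v, h v ≠ 0)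
  (hφ : IsRegularMap φ)

theorem RationalMap.range_ofQuotient :
    Set.range (ofQuotient h φ hh hh0 hφ).toFun = quotientImage h φ := by
  ext w
  constructor
  · rintro ⟨⟨v, hv⟩, rfl⟩
    exact mem_quotientImage φ hv
  · rintro ⟨v, hv, rfl⟩
    exact ⟨⟨v, hv⟩, rfl⟩

theorem IsCovariantQuotient.isFaithfulRationalCovariant {G : Type*} [Group G]
    {ρ : Representation ℂ G V} {σ : Representation ℂ G W} (H : IsCovariantQuotient ρ σ h φ)
    (hf : ActsFaithfullyOn σ (Set.range φ)) :
    IsFaithfulRationalCovariant ρ σ (.ofQuotient h φ hh hh0 hφ) := by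
  refine ⟨?_, ?_⟩
  · rintro g ⟨v, hv⟩ ⟨v', hv'⟩ rfl
    change (h (ρ g v))⁻¹ • φ (ρ g v) = σ g ((h v)⁻¹ • φ v)
    rw [H.invariant, H.covariant.2, map_smul]
  · rw [RationalMap.range_ofQuotient]
    exact actsFaithfullyOn_quotientImage hh hh0 hφ hf

end RationalQuotient

/-! ### Minimal covariants and the main theorem -/

section Main

variable {G : Type v} [Group G]

theorem covdim_le {V W : Type u} [AddCommGroup V] [Module ℂ V] [FiniteDimensional ℂ V]
    [AddCommGroup W] [Module ℂ W] [FiniteDimensional ℂ W] {ρ : Representation ℂ G V}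
    {σ : Representation ℂ G W} {φ : V → W} (h : IsFaithfulCovariant ρ σ φ) :
    covdim.{u} G ≤ zariskiDim (Set.range φ) :=
  sInf_le ⟨V, W, _, _, inferInstance, _, _, inferInstance, ρ, σ, φ, h, rfl⟩

theorem edim_le {V W : Type u} [AddCommGroup V] [Module ℂ V] [FiniteDimensional ℂ V]
    [AddCommGroup W] [Module ℂ W] [FiniteDimensional ℂ W] {ρ : Representation ℂ G V}
    {σ : Representation ℂ G W} {ψ : RationalMap V W} (h : IsFaithfulRationalCovariant ρ σ ψ) :
    edim.{u} G ≤ zariskiDim (Set.range ψ.toFun) :=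
  sInf_le ⟨V, W, _, _, inferInstance, _, _, inferInstance, ρ, σ, ψ, h, rfl⟩

theorem IsFaithfulCovariant.isCovariantQuotient_one {V W : Type*} [AddCommGroup V] [Module ℂ V]
    [AddCommGroup W] [Module ℂ W] {ρ : Representation ℂ G V} {σ : Representation ℂ G W}
    {φ : V → W} (h : IsFaithfulCovariant ρ σ φ) : IsCovariantQuotient ρ σ 1 φ :=
  ⟨const_mem_regularFunctions 1, ⟨0, one_ne_zero⟩, fun _ _ => rfl, h.1⟩

/-- The identity of the faithful module `V` is a faithful covariant, so the infimum runs over a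
nonempty set and is attained. -/
theorem exists_zariskiDim_eq_covdim {V : Type u} [AddCommGroup V] [Module ℂ V]
    [FiniteDimensional ℂ V] {ρ : Representation ℂ G V} (hV : Function.Injective ρ) :
    ∃ (V₀ W₀ : Type u) (_ : AddCommGroup V₀) (_ : Module ℂ V₀) (_ : FiniteDimensional ℂ V₀)
      (_ : AddCommGroup W₀) (_ : Module ℂ W₀) (_ : FiniteDimensional ℂ W₀)
      (ρ₀ : Representation ℂ G V₀) (σ₀ : Representation ℂ G W₀) (φ : V₀ → W₀),
      IsFaithfulCovariant ρ₀ σ₀ φ ∧ covdim.{u} G = zariskiDim (Set.range φ) := by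
  have hid : IsFaithfulCovariant ρ ρ id :=
    ⟨⟨IsRegularMap.linearMap LinearMap.id, fun _ _ => rfl⟩, fun g hg => hV <| by
      rw [map_one]
      exact LinearMap.ext fun v => hg v ⟨v, rfl⟩⟩
  exact csInf_mem (s := {d | ∃ (V W : Type u) (_ : AddCommGroup V) (_ : Module ℂ V)
    (_ : FiniteDimensional ℂ V) (_ : AddCommGroup W) (_ : Module ℂ W) (_ : FiniteDimensional ℂ W)
    (ρ : Representation ℂ G V) (σ : Representation ℂ G W) (φ : V → W),
    IsFaithfulCovariant ρ σ φ ∧ d = zariskiDim (Set.range φ)})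
    ⟨_, V, V, _, _, inferInstance, _, _, inferInstance, ρ, ρ, id, hid, rfl⟩

theorem exists_zariskiDim_eq_edim {V : Type u} [AddCommGroup V] [Module ℂ V]
    [FiniteDimensional ℂ V] {ρ : Representation ℂ G V} (hV : Function.Injective ρ) :
    ∃ (V₀ W₀ : Type u) (_ : AddCommGroup V₀) (_ : Module ℂ V₀) (_ : FiniteDimensional ℂ V₀)
      (_ : AddCommGroup W₀) (_ : Module ℂ W₀) (_ : FiniteDimensional ℂ W₀)
      (ρ₀ : Representation ℂ G V₀) (σ₀ : Representation ℂ G W₀) (ψ : RationalMap V₀ W₀),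
      IsFaithfulRationalCovariant ρ₀ σ₀ ψ ∧ edim.{u} G = zariskiDim (Set.range ψ.toFun) := by
  obtain ⟨V₀, W₀, _, _, _, _, _, _, ρ₀, σ₀, φ, hφ, -⟩ := exists_zariskiDim_eq_covdim hV
  have hq := hφ.isCovariantQuotient_one
  exact csInf_mem (s := {d | ∃ (V W : Type u) (_ : AddCommGroup V) (_ : Module ℂ V)
    (_ : FiniteDimensional ℂ V) (_ : AddCommGroup W) (_ : Module ℂ W) (_ : FiniteDimensional ℂ W)
    (ρ : Representation ℂ G V) (σ : Representation ℂ G W) (ψ : RationalMap V W),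
    IsFaithfulRationalCovariant ρ σ ψ ∧ d = zariskiDim (Set.range ψ.toFun)})
    ⟨_, V₀, W₀, _, _, inferInstance, _, _, inferInstance, ρ₀, σ₀, _,
      hq.isFaithfulRationalCovariant hq.mem hq.exists_ne_zero hq.covariant.1 hφ.2, rfl⟩

variable {ι κ : Type} [Fintype ι] [DecidableEq ι] [Fintype κ] {V : ι → Type u} {W : κ → Type u}
  [∀ i, AddCommGroup (V i)] [∀ i, Module ℂ (V i)]
  [∀ j, AddCommGroup (W j)] [∀ j, Module ℂ (W j)] [∀ j, FiniteDimensional ℂ (W j)]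
  {ρ : ∀ i, Representation ℂ G (V i)} {σ : ∀ j, Representation ℂ G (W j)}

/-- Compression followed by homogenization. -/
theorem IsCovariantQuotient.exists_multihomogeneous [Finite G] (hσ : ∀ j, (σ j).IsIrreducible)
    (hV : Function.Injective (piRep ρ)) {V₀ W₀ : Type*} [AddCommGroup V₀] [Module ℂ V₀]
    [AddCommGroup W₀] [Module ℂ W₀] {ρ₀ : Representation ℂ G V₀} {σ₀ : Representation ℂ G W₀}
    {h : V₀ → ℂ} {φ : V₀ → W₀} (hφ : IsCovariantQuotient ρ₀ σ₀ h φ)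
    (hf : ActsFaithfullyOn σ₀ (Set.range φ)) :
    ∃ h' φ', IsCovariantQuotient (piRep ρ) (piRep σ) h' φ' ∧ (∀ j, ∃ v, φ' v j ≠ 0) ∧
      zariskiDim (quotientImage h' φ') ≤ zariskiDim (quotientImage h φ) ∧ (h = 1 → h' = 1) ∧
      (∃ e : ι → ℕ, ∀ i, IsHomogeneousIn i (e i) h') ∧
      ∃ d : κ → ι → ℕ, ∀ j i, IsHomogeneousIn i (d j i) fun v => φ' v j := by
  have hne : ∀ j, ∃ w : W j, w ≠ 0 := fun j => by
    by_contra! h0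
    obtain ⟨S, T, hST⟩ := (hσ j).exists_pair_ne
    refine hST (Subrepresentation.toSubmodule_injective (Submodule.ext fun w => ?_))
    rw [h0 w]
    simp
  choose w hw using hne
  -- Every component of `w` is nonzero, so no component of `φ₁` vanishes identically.
  obtain ⟨h₁, φ₁, hφ₁, hd₁, hone₁, v, c, hc, hv⟩ := hφ.exists_compression hf (piRep σ) hV w
  have h0₁ : ∀ j, ∃ v, φ₁ v j ≠ 0 := fun j => ⟨v, by
    rw [hv]
    exact smul_ne_zero hc (hw j)⟩
  obtain ⟨h₂, φ₂, hφ₂, h0₂, hd₂, hone₂, hI⟩ := hφ₁.exists_isHomogeneousIn h0₁ Finset.univ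
  choose e he using fun i => (hI i (Finset.mem_univ i)).1
  choose d hd using fun j i => (hI i (Finset.mem_univ i)).2 j
  exact ⟨h₂, φ₂, hφ₂, h0₂, hd₂.trans hd₁, hone₂ ∘ hone₁, ⟨e, he⟩, d, hd⟩

/-- A multihomogeneous quotient `h⁻¹ φ` is minimal, and so is `φ`, if neither exceeds the minimal
dimension. -/
theorem IsCovariantQuotient.exists_minimal_of_zariskiDim_le
    [∀ i, FiniteDimensional ℂ (V i)] (hσ : ∀ j, (σ j).IsIrreducible)
    (hW : Function.Injective (piRep σ)) {h : (∀ i, V i) → ℂ} {φ : (∀ i, V i) → ∀ j, W j}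
    (H : IsCovariantQuotient (piRep ρ) (piRep σ) h φ) (h0 : ∀ j, ∃ v, φ v j ≠ 0)
    {e : ι → ℕ} (he : ∀ i, IsHomogeneousIn i (e i) h) {d : κ → ι → ℕ}
    (hd : ∀ j i, IsHomogeneousIn i (d j i) fun v => φ v j)
    (hedim : zariskiDim (quotientImage h φ) ≤ edim.{u} G)
    (hcovdim : zariskiDim (Set.range φ) ≤ covdim.{u} G) :
    ∃ (ψ : RationalMap (∀ i, V i) (∀ j, W j)) (h : (∀ i, V i) → ℂ)
      (φ : (∀ i, V i) → ∀ j, W j),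
      IsMinimalRationalCovariant (piRep ρ) (piRep σ) ψ ∧
      (∃ A : Matrix κ ι ℤ, ψ.IsMultihomogeneousOfDegree A) ∧
      (∀ j, ∃ v, ψ.toFun v j ≠ 0) ∧
      IsMultihomogeneousInvariant ρ h ∧
      IsMinimalCovariant (piRep ρ) (piRep σ) φ ∧
      (∃ B : Matrix κ ι ℤ, IsMultihomogeneousOfDegree B φ) ∧
      ψ.EqQuotient h φ := by
  have hf := actsFaithfullyOn_range_of_forall_exists_ne_zero hσ hW H.covariant h0
  set ψ := RationalMap.ofQuotient h φ H.mem H.exists_ne_zero H.covariant.1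
  have hψ : IsFaithfulRationalCovariant (piRep ρ) (piRep σ) ψ :=
    H.isFaithfulRationalCovariant _ _ _ hf
  have hφ : IsFaithfulCovariant (piRep ρ) (piRep σ) φ := ⟨H.covariant, hf⟩
  have hψ0 : ∀ j, ∃ v, ψ.toFun v j ≠ 0 := fun j => by
    obtain ⟨v, hv⟩ := h0 j
    obtain ⟨f, hf, hfv, hfφ⟩ := exists_mem_regularFunctions_ne_zero (H.covariant.1.apply j) hv
    obtain ⟨w, hw, hw'⟩ := exists_mul_ne_zero H.mem hf H.exists_ne_zero ⟨v, hfv⟩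
    exact ⟨⟨w, hw⟩, smul_ne_zero (inv_ne_zero hw) (hfφ w hw')⟩
  refine ⟨ψ, h, φ, ⟨hψ, le_antisymm ?_ (edim_le hψ)⟩, ⟨fun j i => (d j i : ℤ) - e i, hψ0, ?_⟩, hψ0,
    ⟨H.mem, fun h1 => ?_, H.invariant, e, fun i s v => he i s v⟩,
    ⟨hφ, le_antisymm hcovdim (covdim_le hφ)⟩,
    ⟨fun j i => d j i, h0, fun j i s _ v => ?_⟩, fun v _ => rfl⟩
  · rwa [RationalMap.range_ofQuotient]
  · rintro j i s hs ⟨v, hv⟩ ⟨v', hv'⟩ rfl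
    change (h (scaleAt i s v))⁻¹ • φ (scaleAt i s v) j = s ^ ((d j i : ℤ) - e i) • (h v)⁻¹ • φ v j
    have hd' : φ (scaleAt i s v) j = s ^ d j i • φ v j := hd j i s v
    rw [he i s v, hd', zpow_sub₀ hs, zpow_natCast, zpow_natCast, smul_smul, smul_smul,
      smul_eq_mul, mul_inv]
    congr 1
    ring
  · obtain ⟨v, hv⟩ := H.exists_ne_zero
    exact hv (by rw [h1]; rfl)
  · rw [zpow_natCast]
    exact hd j i s v

end Main

theorem theorem2p5 {G : Type v} [Group G] [Finite G] {n m : ℕ}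
    {V : Fin n → Type u} {W : Fin m → Type u}
    [∀ i, AddCommGroup (V i)] [∀ i, Module ℂ (V i)] [∀ i, FiniteDimensional ℂ (V i)]
    [∀ j, AddCommGroup (W j)] [∀ j, Module ℂ (W j)] [∀ j, FiniteDimensional ℂ (W j)]
    (ρ : ∀ i, Representation ℂ G (V i)) (σ : ∀ j, Representation ℂ G (W j))
    (hρ : ∀ i, (ρ i).IsIrreducible) (hσ : ∀ j, (σ j).IsIrreducible)
    (hV : Function.Injective (piRep ρ)) (hW : Function.Injective (piRep σ)) :
    ∃ (ψ : RationalMap (∀ i, V i) (∀ j, W j)) (h : (∀ i, V i) → ℂ)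
      (φ : (∀ i, V i) → ∀ j, W j),
      IsMinimalRationalCovariant (piRep ρ) (piRep σ) ψ ∧
      (∃ A : Matrix (Fin m) (Fin n) ℤ, ψ.IsMultihomogeneousOfDegree A) ∧
      (∀ j, ∃ v, ψ.toFun v j ≠ 0) ∧
      IsMultihomogeneousInvariant ρ h ∧
      IsMinimalCovariant (piRep ρ) (piRep σ) φ ∧
      (∃ B : Matrix (Fin m) (Fin n) ℤ, IsMultihomogeneousOfDegree B φ) ∧
      ψ.EqQuotient h φ := by
  obtain ⟨V₀, W₀, _, _, _, _, _, _, ρ₀, σ₀, φ₀, hφ₀, hcov⟩ := exists_zariskiDim_eq_covdim hV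
  obtain ⟨V₁, W₁, _, _, _, _, _, _, ρ₁, σ₁, ψ₁, hψ₁, hed⟩ := exists_zariskiDim_eq_edim hV
  obtain ⟨h₁, φ₁, hφ₁, hf₁, hsub⟩ := hψ₁.exists_isCovariantQuotient
  obtain ⟨h, φ, H, h0, hdim, -, ⟨e, he⟩, d, hd⟩ := hφ₁.exists_multihomogeneous hσ hV hf₁
  have hle : zariskiDim (quotientImage h φ) ≤ edim.{u} G := by
    rw [hed]
    exact hdim.trans (zariskiDim_mono hsub)
  rcases lt_or_ge (edim.{u} G) (covdim.{u} G) with hlt | hge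
  · refine H.exists_minimal_of_zariskiDim_le hσ hW h0 he hd hle ?_
    calc zariskiDim (Set.range φ) ≤ zariskiDim (quotientImage h φ) + 1 :=
          zariskiDim_range_le_add_one H.mem H.exists_ne_zero H.covariant.1
      _ ≤ edim.{u} G + 1 := by gcongr
      _ ≤ covdim.{u} G := Order.add_one_le_of_lt hlt
  -- Here covdim ≤ edim, so a homogenized minimal regular covariant with denominator 1 is also
  -- minimal as a rational one.
  · obtain ⟨h', φ', H', h0', hdim', hone, ⟨e', he'⟩, d', hd'⟩ :=
      hφ₀.isCovariantQuotient_one.exists_multihomogeneous hσ hV hφ₀.2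
    obtain rfl := hone rfl
    rw [quotientImage_one, quotientImage_one, ← hcov] at hdim'
    refine H'.exists_minimal_of_zariskiDim_le hσ hW h0' he' hd' ?_ hdim'
    rw [quotientImage_one]
    exact hdim'.trans hge
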